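/- For $K \ge 1$, a homeomorphism $\phi : \mathbb{C} \to \mathbb{C}$ is called $K$-quasiconformal if it is orientation preserving, belongs to $W^{1,2}_{loc}(\mathbb{C})$ and satisfies $\max_\alpha |\partial_\alpha \phi| \le K \min_\alpha |\partial_\alpha \phi|$ almost everywhere, where $\partial_\alpha$ is the derivative in the direction $e^{i\alpha}$. A gauge function is a continuous non-decreasing function $g : [0,\infty) \to [0,\infty)$ with $\lim_{t \to 0} g(t) = 0$ and $g(t) > 0$ for $t > 0$; the associated Hausdorff measure is $$\mathcal{H}^g(F) = \lim_{\delta \to 0} \, \inf \Big\{ \sum_j g(2 r_j) : F \subset \bigcup_j B(z_j, r_j), \ 2 r_j < \delta \Big\},$$ the infimum being over countable coverings of $F \subset \mathbb{C}$ by disks. $\mathcal{H}^s$ denotes the usual $s$-dimensional Hausdorff measure. Corollary 3.4. Let $K \ge 1$, $0 < d < 2$ and $d' = \frac{2Kd}{2+(K-1)d}$. Then there exist a compact set $E \subset \mathbb{C}$ and a $K$-quasiconformal mapping $\phi : \mathbb{C} \to \mathbb{C}$ such that $$0 < \mathcal{H}^d(E) < \infty \quad\text{and}\quad 0 < \mathcal{H}^{d'}(\phi(E))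 < \infty .$$ Moreover, the hypothesis of the implication $$\mathcal{H}^d(E) = 0 \implies \mathcal{H}^{d'}(\phi(E)) = 0 \qquad (E \text{ compact}, \ \phi : \mathbb{C} \to \mathbb{C} \ K\text{-quasiconformal})$$ is sharp, in the sense that no relaxation of it in terms of gauge functions allows the same conclusion: for every gauge function $g$ with $g(t)/t^d \to 0$ as $t \to 0^+$, it is not true that $\mathcal{H}^g(E) = 0$ implies $\mathcal{H}^{d'}(\phi(E)) = 0$ for all compact sets $E \subset \mathbb{C}$ and all $K$-quasiconformal mappings $\phi : \mathbb{C} \to \mathbb{C}$. -/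

import Mathlib

open Set Filter Topology MeasureTheory
open scoped ENNReal ContDiff

noncomputable section

/-- `g` is a weak partial derivative of `f : ℂ → ℂ` in the direction `v ∈ ℂ = ℝ²`, on the whole
plane: `∫ (∂_v ψ) f = - ∫ ψ g` for every real test function `ψ ∈ C_c^∞(ℂ)`. -/
def IsWeakPartial (v : ℂ) (f g : ℂ → ℂ) : Prop :=
  ∀ ψ : ℂ → ℝ, ContDiff ℝ ∞ ψ → HasCompactSupport ψ →
    ∫ z, (fderiv ℝ ψ z v) • f z = - ∫ z, ψ z • g z

/-- `f ∈ L²_loc(ℂ)`. -/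
def IsL2Loc (f : ℂ → ℂ) : Prop :=
  ∀ C : Set ℂ, IsCompact C → MemLp f 2 (volume.restrict C)

/-- `φ : ℂ → ℂ` is a `K`-quasiconformal mapping of the plane: an orientation preserving
homeomorphism of class `W^{1,2}_loc(ℂ)` with `max_α |∂_α φ| ≤ K min_α |∂_α φ|` almost everywhere.

Here `p` and `q` are the weak partial derivatives `∂_x φ` and `∂_y φ`, which are unique almost
everywhere, `∂_α φ = cos α ∂_x φ + sin α ∂_y φ` is the derivative in the direction `e^{iα}`, and
"orientation preserving" is expressed, as usual for Sobolev homeomorphisms, by the Jacobian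
`J_φ = Re (∂_x φ) Im (∂_y φ) - Im (∂_x φ) Re (∂_y φ)` being nonnegative almost everywhere. -/
def IsQuasiconformal (K : ℝ) (φ : ℂ → ℂ) : Prop :=
  IsHomeomorph φ ∧ IsL2Loc φ ∧
    ∃ p q : ℂ → ℂ, IsWeakPartial 1 φ p ∧ IsWeakPartial Complex.I φ q ∧ IsL2Loc p ∧ IsL2Loc q ∧
      (∀ᵐ z : ℂ, ∀ α β : ℝ,
        ‖(Real.cos α : ℂ) * p z + (Real.sin α : ℂ) * q z‖ ≤
          K * ‖(Real.cos β : ℂ) * p z + (Real.sin β : ℂ) * q z‖) ∧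
      (∀ᵐ z : ℂ, 0 ≤ (p z).re * (q z).im - (p z).im * (q z).re)

/-- A gauge function (measure function): continuous and non-decreasing on `[0, ∞)`,
tending to `0` at `0`, and positive on `(0, ∞)`. Only the values on `[0, ∞)` matter. -/
structure IsGauge (h : ℝ → ℝ) : Prop where
  continuousOn : ContinuousOn h (Ici 0)
  monotoneOn : MonotoneOn h (Ici 0)
  tendsto_zero : Tendsto h (𝓝[>] 0) (𝓝 0)
  pos : ∀ t, 0 < t → 0 < h t

/-- The partial order `g ≺ h` on gauge functions: `h(t) / g(t) → 0` as `t → 0⁺`. -/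
def GaugePrec (g h : ℝ → ℝ) : Prop :=
  Tendsto (fun t => h t / g t) (𝓝[>] 0) (𝓝 0)

/-- The generalized Hausdorff measure `H^h(F)` of `F ⊆ ℂ` for a gauge function `h`: the limit
(supremum) as `δ → 0` of the infimum of `∑ h (2 r_j)` over all countable coverings of `F` by disks
`B(z_j, r_j)` of diameter `2 r_j < δ`. Finite coverings are included, as `B(z, 0)` is empty and
`h 0 = 0`. -/
def gaugeHausdorff (h : ℝ → ℝ) (F : Set ℂ) : ℝ≥0∞ :=
  ⨆ (δ : ℝ) (_ : 0 < δ),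
    ⨅ (z : ℕ → ℂ) (r : ℕ → ℝ) (_ : ∀ j, 0 ≤ r j ∧ 2 * r j < δ)
      (_ : F ⊆ ⋃ j, Metric.ball (z j) (r j)),
      ∑' j, ENNReal.ofReal (h (2 * r j))

/-- For the gauge `t ^ a` the disk definition is comparable with Mathlib's Hausdorff measure
`μH[a]`: lower bound. -/
theorem hausdorffMeasure_le_gaugeHausdorff (a : ℝ) (ha : 0 < a) (F : Set ℂ) :
    μH[a] F ≤ gaugeHausdorff (fun t => t ^ a) F := by
  rw [Measure.hausdorffMeasure_apply]
  refine iSup₂_le fun ρ hρ => ?_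
  obtain ⟨δ, hδ, hδρ⟩ : ∃ δ : ℝ, 0 < δ ∧ ENNReal.ofReal δ ≤ ρ := by
    rcases eq_or_ne ρ ⊤ with rfl | h
    · exact ⟨1, one_pos, le_top⟩
    · exact ⟨ρ.toReal, ENNReal.toReal_pos hρ.ne' h, ENNReal.ofReal_toReal_le⟩
  refine le_trans ?_ (le_iSup₂ (α := ℝ≥0∞) δ hδ)
  refine le_iInf fun z => le_iInf fun r => le_iInf fun hr => le_iInf fun hF => ?_
  have hd : ∀ j, Metric.ediam (Metric.ball (z j) (r j)) ≤ ENNReal.ofReal (2 * r j) := by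
    intro j
    refine Metric.ediam_le fun x hx y hy => ?_
    rw [edist_dist]
    refine ENNReal.ofReal_le_ofReal ?_
    have h1 := dist_triangle_right x y (z j)
    have h2 := Metric.mem_ball.1 hx
    have h3 := Metric.mem_ball.1 hy
    linarith
  refine iInf_le_of_le (fun j => Metric.ball (z j) (r j)) (iInf_le_of_le hF
    (iInf_le_of_le (fun j => ((hd j).trans (ENNReal.ofReal_le_ofReal (hr j).2.le)).trans hδρ) ?_))
  refine ENNReal.tsum_le_tsum fun j => iSup_le fun _ => ?_
  rw [← ENNReal.ofReal_rpow_of_nonneg (by linarith [(hr j).1]) ha.le]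
  exact ENNReal.rpow_le_rpow (hd j) ha.le

/-- For the gauge `t ^ a` the disk definition is comparable with Mathlib's Hausdorff measure
`μH[a]`: upper bound. -/
theorem gaugeHausdorff_le_hausdorffMeasure (a : ℝ) (ha : 0 < a) (F : Set ℂ) :
    gaugeHausdorff (fun t => t ^ a) F ≤ 2 ^ a * μH[a] F := by
  refine iSup₂_le fun δ hδ => ?_
  rw [Measure.hausdorffMeasure_apply]
  refine le_trans ?_ (mul_le_mul_right (le_iSup₂ (α := ℝ≥0∞)
    (ENNReal.ofReal (δ / 4)) (ENNReal.ofReal_pos.2 (by linarith))) _)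
  have h2 : (2 : ℝ≥0∞) ^ a ≠ ⊤ := ENNReal.rpow_ne_top_of_nonneg ha.le (by simp)
  simp only [ENNReal.mul_iInf_of_ne (by simp : (2 : ℝ≥0∞) ^ a ≠ 0) h2]
  refine le_iInf fun t => le_iInf fun hF => le_iInf fun ht => ?_
  refine ENNReal.le_of_forall_pos_le_add fun ε hε _ => ?_
  obtain ⟨e, he, hes⟩ := ENNReal.exists_pos_sum_of_countable (ENNReal.coe_pos.2 hε).ne' ℕ
  have key : ∀ j, ∃ (z : ℂ) (r : ℝ), (0 ≤ r ∧ 2 * r < δ) ∧ t j ⊆ Metric.ball z r ∧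
      ENNReal.ofReal ((2 * r) ^ a) ≤
        2 ^ a * (⨆ _ : (t j).Nonempty, Metric.ediam (t j) ^ a) + e j := by
    intro j
    rcases (t j).eq_empty_or_nonempty with h | ⟨x, hx⟩
    · exact ⟨0, 0, ⟨le_rfl, by simpa using hδ⟩, by simp [h], by simp [Real.zero_rpow ha.ne']⟩
    have hfin : Metric.ediam (t j) ≠ ⊤ := ((ht j).trans_lt ENNReal.ofReal_lt_top).ne
    set s : ℝ := (Metric.ediam (t j)).toReal with hs
    have hs0 : 0 ≤ s := ENNReal.toReal_nonneg
    have hsd : s ≤ δ / 4 := ENNReal.toReal_le_of_le_ofReal (by linarith) (ht j)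
    have hes' : ENNReal.ofReal s = Metric.ediam (t j) := ENNReal.ofReal_toReal hfin
    have hc : ContinuousAt (fun r : ℝ => (2 * r) ^ a) s :=
      ((continuous_const.mul continuous_id).continuousAt).rpow_const (Or.inr ha.le)
    have hev : ∀ᶠ r in 𝓝[>] s, (2 * r) ^ a < (2 * s) ^ a + (e j : ℝ) ∧ r < δ / 2 ∧ s < r := by
      have h1 : ∀ᶠ r in 𝓝 s, (2 * r) ^ a < (2 * s) ^ a + (e j : ℝ) :=
        hc.eventually_lt_const (lt_add_of_pos_right _ (NNReal.coe_pos.2 (he j)))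
      have h3 : ∀ᶠ r in 𝓝 s, r < δ / 2 := eventually_lt_nhds (by linarith)
      filter_upwards [h1.filter_mono nhdsWithin_le_nhds, h3.filter_mono nhdsWithin_le_nhds,
        self_mem_nhdsWithin] with r u v w
      exact ⟨u, v, w⟩
    obtain ⟨r, hr1, hr2, hr3⟩ := hev.exists
    refine ⟨x, r, ⟨by linarith, by linarith⟩, fun y hy => ?_, ?_⟩
    · rw [Metric.mem_ball]
      refine lt_of_le_of_lt ?_ hr3
      rw [hs, dist_edist]
      exact ENNReal.toReal_mono hfin (Metric.edist_le_ediam_of_mem hy hx)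
    · rw [ciSup_pos ⟨x, hx⟩, ← hes', ENNReal.ofReal_rpow_of_nonneg hs0 ha.le]
      have e2 : (2 : ℝ≥0∞) ^ a = ENNReal.ofReal ((2 : ℝ) ^ a) := by
        rw [← ENNReal.ofReal_rpow_of_nonneg zero_le_two ha.le]; simp
      rw [e2, ← ENNReal.ofReal_mul (by positivity), ← Real.mul_rpow zero_le_two hs0,
        ← ENNReal.ofReal_coe_nnreal, ← ENNReal.ofReal_add (by positivity) (NNReal.coe_nonneg _)]
      exact ENNReal.ofReal_le_ofReal hr1.le
  choose z r hr hsub hle using key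
  refine iInf_le_of_le z (iInf_le_of_le r (iInf_le_of_le hr (iInf_le_of_le
    (hF.trans (iUnion_mono hsub)) ?_)))
  calc ∑' j, ENNReal.ofReal ((2 * r j) ^ a)
      ≤ ∑' j, (2 ^ a * (⨆ _ : (t j).Nonempty, Metric.ediam (t j) ^ a) + e j) :=
        ENNReal.tsum_le_tsum hle
    _ = 2 ^ a * ∑' j, (⨆ _ : (t j).Nonempty, Metric.ediam (t j) ^ a) + ∑' j, (e j : ℝ≥0∞) := by
        rw [ENNReal.tsum_add, ENNReal.tsum_mul_left]
    _ ≤ _ := by gcongr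

end

/-!
For `a ≥ 1`, let `C_a` be the Cantor set obtained from a sequence of disk packings of the unit disk
by replacing at each generation every disk of radius `R` by a concentric one of radius `R ^ a`, into
which the next packing is scaled. As a packing satisfies `∑ R ^ 2 = ∑ (R ^ a) ^ (2 / a) ≤ 1`, the
natural covers show that `C_a` has finite `2 / a`-dimensional measure. If the packings fill almost
all of the area, then `C_1` has positive area; the correspondence of points with the same address is
a `1 / a`-Hölder map of `C_a` onto `C_1`, so the `2 / a`-dimensional measure of `C_a` is positive.

On each annulus `R ^ a < |z| < R` the radial stretching `z ↦ |z| ^ (1 / K - 1) z`, suitably scaled,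
is `K`-quasiconformal. Gluing these stretchings over all generations gives a `K`-quasiconformal map
of the plane carrying `C_a` onto `C_b`, where `b - 1 = (a - 1) / K`. With `a = 2 / d` this is the
extremal pair, since `d' = 2 / b`. The weak derivatives of the limit map are controlled on the small
sets where it differs from its approximations, because energy is at most `K` times image area.

A gauge `g` with `g(t) / t ^ d → 0` has `H^g(C_a) = 0`, as `H^d(C_a) < ∞`, so the extremal pair is
also the counterexample to every relaxed implication.
-/

open Metric

/-! ### Disk packings and their Cantor sets -/

theorem exists_finset_pairwiseDisjoint_closedBall {α : Type*} [MetricSpace α]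
    [SecondCountableTopology α] [MeasurableSpace α] [OpensMeasurableSpace α]
    [HasBesicovitchCovering α] (μ : Measure α) [SFinite μ] {s : Set α} {R : α → ℝ}
    (hR : ∀ x ∈ s, 0 < R x) {m : ℝ≥0∞} (hm : m < μ s) :
    ∃ t : Finset (α × ℝ), (∀ p ∈ t, p.1 ∈ s ∧ 0 < p.2 ∧ p.2 < R p.1) ∧
      ((t : Set (α × ℝ)).PairwiseDisjoint fun p => closedBall p.1 p.2) ∧
      m < μ (⋃ p ∈ t, closedBall p.1 p.2) := by
  obtain ⟨t, ht_count, hts, htR, ht_cover, ht_disj⟩ :=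
    Besicovitch.exists_disjoint_closedBall_covering_ae_aux μ (fun x => Ioo 0 (R x)) s
      fun x hx δ hδ => ⟨min (R x) δ / 2, by
        have := lt_min (hR x hx) hδ
        have := min_le_left (R x) δ
        have := min_le_right (R x) δ
        constructor <;> constructor <;> linarith⟩
  have hm_sum : m < ∑' p : t, μ (closedBall p.1.1 p.1.2) := by
    rw [← measure_biUnion ht_count ht_disj fun _ _ => measurableSet_closedBall]
    exact hm.trans_le (measure_mono_ae (ae_le_set.2 ht_cover))
  obtain ⟨u, hu⟩ := lt_iSup_iff.1 (ENNReal.tsum_eq_iSup_sum ▸ hm_sum)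
  have hut : ∀ p ∈ u.map (Function.Embedding.subtype _), p ∈ t := by simp +contextual
  have hu_disj := ht_disj.subset hut
  refine ⟨u.map (Function.Embedding.subtype _), fun p hp => ⟨hts p (hut p hp), htR p (hut p hp)⟩,
    hu_disj, ?_⟩
  rwa [measure_biUnion_finset hu_disj fun _ _ => measurableSet_closedBall, Finset.sum_map]

/-- A finite family of pairwise disjoint closed disks in the closed unit disk, a disk being given
as the pair `(c, R)` of its centre and its radius. -/
structure DiskPacking where
  disks : Finset (ℂ × ℝ)
  pos : ∀ p ∈ disks, 0 < p.2
  le_half : ∀ p ∈ disks, p.2 ≤ 1 / 2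
  norm_add_radius_le : ∀ p ∈ disks, ‖p.1‖ + p.2 ≤ 1
  add_lt_norm : ∀ p ∈ disks, ∀ q ∈ disks, p ≠ q → p.2 + q.2 < ‖p.1 - q.1‖

namespace DiskPacking

theorem pairwiseDisjoint (P : DiskPacking) :
    (P.disks : Set (ℂ × ℝ)).PairwiseDisjoint fun p => closedBall p.1 p.2 := fun p hp q hq hpq =>
  closedBall_disjoint_closedBall (by simpa [dist_eq_norm] using P.add_lt_norm p hp q hq hpq)

theorem closedBall_subset (P : DiskPacking) {p : ℂ × ℝ} (hp : p ∈ P.disks) :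
    closedBall p.1 p.2 ⊆ closedBall 0 1 :=
  closedBall_subset_closedBall' (by rw [dist_zero_right, add_comm]; exact P.norm_add_radius_le p hp)

theorem le_one (P : DiskPacking) {p : ℂ × ℝ} (hp : p ∈ P.disks) : p.2 ≤ 1 :=
  (P.le_half p hp).trans (by norm_num)

theorem rpow_le (P : DiskPacking) {a : ℝ} (ha : 1 ≤ a) {p : ℂ × ℝ} (hp : p ∈ P.disks) :
    p.2 ^ a ≤ p.2 :=
  Real.rpow_le_self_of_le_one (P.pos p hp).le (P.le_one hp) ha

theorem rpow_pos (P : DiskPacking) (a : ℝ) {p : ℂ × ℝ} (hp : p ∈ P.disks) : 0 < p.2 ^ a :=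
  Real.rpow_pos_of_pos (P.pos p hp) a

theorem volume_biUnion (P : DiskPacking) :
    volume (⋃ p ∈ P.disks, closedBall p.1 p.2) =
      ENNReal.ofReal (∑ p ∈ P.disks, p.2 ^ 2) * NNReal.pi := by
  rw [measure_biUnion_finset P.pairwiseDisjoint fun _ _ => measurableSet_closedBall,
    ENNReal.ofReal_sum_of_nonneg fun _ _ => sq_nonneg _, Finset.sum_mul]
  refine Finset.sum_congr rfl fun p hp => ?_
  rw [Complex.volume_closedBall, ENNReal.ofReal_pow (P.pos p hp).le]

theorem sum_sq_le_one (P : DiskPacking) : ∑ p ∈ P.disks, p.2 ^ 2 ≤ 1 := by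
  have h : volume (⋃ p ∈ P.disks, closedBall p.1 p.2) ≤ volume (closedBall (0 : ℂ) 1) :=
    measure_mono (iUnion₂_subset fun p hp => P.closedBall_subset hp)
  rwa [P.volume_biUnion, Complex.volume_closedBall, ENNReal.mul_le_mul_iff_left
    (by simpa using NNReal.pi_ne_zero) ENNReal.coe_ne_top, ENNReal.ofReal_one, one_pow,
    ENNReal.ofReal_le_one] at h

theorem exists_one_sub_le_sum_sq {δ ε : ℝ} (hδ : 0 < δ) (hε : 0 < ε) :
    ∃ P : DiskPacking, (∀ p ∈ P.disks, p.2 ≤ δ) ∧ 1 - ε ≤ ∑ p ∈ P.disks, p.2 ^ 2 := by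
  have hvol : ENNReal.ofReal (1 - ε) * NNReal.pi < volume (ball (0 : ℂ) 1) := by
    rw [Complex.volume_ball, ENNReal.mul_lt_mul_iff_left (by simpa using NNReal.pi_ne_zero)
      ENNReal.coe_ne_top, ENNReal.ofReal_one, one_pow, ENNReal.ofReal_lt_one]
    linarith
  obtain ⟨t, ht, ht_disj, ht_vol⟩ := exists_finset_pairwiseDisjoint_closedBall volume
    (R := fun x => min (1 - ‖x‖) (min δ (1 / 2)))
    (fun x hx => lt_min (by simpa using hx) (lt_min hδ one_half_pos)) hvol
  simp only [lt_min_iff] at ht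
  let P : DiskPacking :=
    { disks := t
      pos := fun p hp => (ht p hp).2.1
      le_half := fun p hp => (ht p hp).2.2.2.2.le
      norm_add_radius_le := fun p hp => by linarith [(ht p hp).2.2.1]
      add_lt_norm := fun p hp q hq hpq => by
        rw [← dist_eq_norm, ← disjoint_closedBall_closedBall_iff (ht p hp).2.1.le (ht q hq).2.1.le]
        exact ht_disj hp hq hpq }
  refine ⟨P, fun p hp => (ht p hp).2.2.2.1.le, ?_⟩
  have h : ENNReal.ofReal (1 - ε) * NNReal.pi < volume (⋃ p ∈ P.disks, closedBall p.1 p.2) := ht_vol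
  rw [P.volume_biUnion, ENNReal.mul_lt_mul_iff_left (by simpa using NNReal.pi_ne_zero)
    ENNReal.coe_ne_top] at h
  exact (ENNReal.ofReal_lt_ofReal_iff'.1 h).1.le

end DiskPacking

/-- The similarity of the plane carrying the closed unit disk onto the closed disk of radius `R ^ a`
which is concentric with the disk `p = (c, R)`. -/
noncomputable def diskEmbed (a : ℝ) (p : ℂ × ℝ) (z : ℂ) : ℂ := p.1 + (p.2 ^ a : ℝ) • z

theorem continuous_diskEmbed (a : ℝ) (p : ℂ × ℝ) : Continuous (diskEmbed a p) := by
  unfold diskEmbed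
  fun_prop

theorem norm_diskEmbed_sub_diskEmbed {p : ℂ × ℝ} (hp : 0 ≤ p.2) (a : ℝ) (z w : ℂ) :
    ‖diskEmbed a p z - diskEmbed a p w‖ = p.2 ^ a * ‖z - w‖ := by
  rw [diskEmbed, diskEmbed, add_sub_add_left_eq_sub, ← smul_sub, norm_smul,
    Real.norm_of_nonneg (Real.rpow_nonneg hp a)]

theorem norm_diskEmbed_sub {p : ℂ × ℝ} (hp : 0 ≤ p.2) (a : ℝ) (z : ℂ) :
    ‖diskEmbed a p z - p.1‖ = p.2 ^ a * ‖z‖ := by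
  rw [diskEmbed, add_sub_cancel_left, norm_smul, Real.norm_of_nonneg (Real.rpow_nonneg hp a)]

open scoped Pointwise in
theorem volume_image_diskEmbed (a : ℝ) (p : ℂ × ℝ) (s : Set ℂ) :
    volume (diskEmbed a p '' s) = ENNReal.ofReal ((p.2 ^ a) ^ 2) * volume s := by
  have : diskEmbed a p '' s = (p.1 + ·) '' ((p.2 ^ a : ℝ) • s) := by
    rw [← image_smul, image_image]
    rfl
  rw [this, image_add_left, measure_preimage_add, Measure.addHaar_smul,
    Complex.finrank_real_complex, abs_of_nonneg (sq_nonneg _)]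

theorem DiskPacking.diskEmbed_mem_closedBall (P : DiskPacking) {a : ℝ} (ha : 1 ≤ a) {p : ℂ × ℝ}
    (hp : p ∈ P.disks) {z : ℂ} (hz : ‖z‖ ≤ 1) : diskEmbed a p z ∈ closedBall p.1 p.2 := by
  rw [mem_closedBall_iff_norm, norm_diskEmbed_sub (P.pos p hp).le]
  exact (mul_le_of_le_one_right (P.rpow_pos a hp).le hz).trans (P.rpow_le ha hp)

/-- The `N`-th stage of the Cantor construction started at level `k`: at level `n`, each disk is
replaced by scaled copies of the disks of `P n` whose radii `R` are changed into `R ^ a`. -/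
def cantorStage (P : ℕ → DiskPacking) (a : ℝ) : ℕ → ℕ → Set ℂ
  | 0, _ => closedBall 0 1
  | N + 1, k => ⋃ p ∈ (P k).disks, diskEmbed a p '' cantorStage P a N (k + 1)

theorem isCompact_cantorStage (P : ℕ → DiskPacking) (a : ℝ) (N k : ℕ) :
    IsCompact (cantorStage P a N k) := by
  induction N generalizing k with
  | zero => exact isCompact_closedBall _ _
  | succ N ih =>
    exact (P k).disks.isCompact_biUnion fun p _ => (ih (k + 1)).image (continuous_diskEmbed a p)

theorem cantorStage_subset_closedBall (P : ℕ → DiskPacking) {a : ℝ} (ha : 1 ≤ a) (N k : ℕ) :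
    cantorStage P a N k ⊆ closedBall 0 1 := by
  induction N generalizing k with
  | zero => exact subset_rfl
  | succ N ih =>
    refine iUnion₂_subset fun p hp => image_subset_iff.2 fun z hz => ?_
    exact (P k).closedBall_subset hp
      ((P k).diskEmbed_mem_closedBall ha hp (by simpa using ih (k + 1) hz))

theorem antitone_cantorStage (P : ℕ → DiskPacking) {a : ℝ} (ha : 1 ≤ a) (k : ℕ) :
    Antitone fun N => cantorStage P a N k := by
  refine antitone_nat_of_succ_le fun N => ?_
  induction N generalizing k with
  | zero => exact cantorStage_subset_closedBall P ha 1 k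
  | succ N ih => exact iUnion₂_mono fun p _ => image_mono (ih (k + 1))

/-- The Cantor set `C_a`, the intersection of all the stages with radii `R ^ a`. -/
def packingCantor (P : ℕ → DiskPacking) (a : ℝ) : Set ℂ := ⋂ N, cantorStage P a N 0

theorem isCompact_packingCantor (P : ℕ → DiskPacking) (a : ℝ) : IsCompact (packingCantor P a) :=
  (isCompact_cantorStage P a 0 0).of_isClosed_subset
    (isClosed_iInter fun N => (isCompact_cantorStage P a N 0).isClosed) (iInter_subset _ 0)

theorem ediam_closedBall_le_ofReal {X : Type*} [PseudoMetricSpace X] (x : X) (r : ℝ) :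
    ediam (closedBall x r) ≤ ENNReal.ofReal (2 * r) := by
  refine ediam_le_of_forall_dist_le fun y hy z hz => ?_
  linarith [dist_triangle_right y z x, mem_closedBall.1 hy, mem_closedBall.1 hz]

theorem hausdorffMeasure_le_of_forall_exists_cover {X : Type*} [MetricSpace X]
    [MeasurableSpace X] [BorelSpace X] {s C : ℝ} (hs : 0 ≤ s) {F : Set X}
    (hF : ∀ δ > 0, ∃ (ι : Type) (_ : Fintype ι) (c : ι → X) (ρ : ι → ℝ),
      (∀ i, 0 ≤ ρ i ∧ ρ i ≤ δ) ∧ F ⊆ ⋃ i, closedBall (c i) (ρ i) ∧ ∑ i, ρ i ^ s ≤ C) :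
    μH[s] F ≤ ENNReal.ofReal (2 ^ s * C) := by
  choose ι hι c ρ hρ hc hC using fun N : ℕ => hF (1 / ((N : ℝ) + 1)) Nat.one_div_pos_of_nat
  refine (Measure.hausdorffMeasure_le_liminf_sum s F (l := atTop)
    (fun N : ℕ => ENNReal.ofReal (2 * (1 / ((N : ℝ) + 1)))) ?_
    (fun N i => closedBall (c N i) (ρ N i)) ?_ (.of_forall hc)).trans ?_
  · simpa using ENNReal.tendsto_ofReal
      ((tendsto_one_div_add_atTop_nhds_zero_nat (𝕜 := ℝ)).const_mul 2)
  · refine .of_forall fun N i => (ediam_closedBall_le_ofReal _ _).trans ?_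
    exact ENNReal.ofReal_le_ofReal (mul_le_mul_of_nonneg_left (hρ N i).2 zero_le_two)
  refine liminf_le_of_le (by isBoundedDefault) fun b hb => ?_
  obtain ⟨N, hN⟩ := hb.exists
  calc b ≤ ∑ i, ediam (closedBall (c N i) (ρ N i)) ^ s := hN
    _ ≤ ∑ i, ENNReal.ofReal (2 ^ s * ρ N i ^ s) := by
      refine Finset.sum_le_sum fun i _ => ?_
      rw [← Real.mul_rpow zero_le_two (hρ N i).1,
        ← ENNReal.ofReal_rpow_of_nonneg (mul_nonneg zero_le_two (hρ N i).1) hs]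
      exact ENNReal.rpow_le_rpow (ediam_closedBall_le_ofReal _ _) hs
    _ = ENNReal.ofReal (2 ^ s * ∑ i, ρ N i ^ s) := by
      rw [Finset.mul_sum, ENNReal.ofReal_sum_of_nonneg]
      exact fun i _ => mul_nonneg (by positivity) (Real.rpow_nonneg (hρ N i).1 _)
    _ ≤ ENNReal.ofReal (2 ^ s * C) := by gcongr; exact hC N

theorem rpow_mul_rpow_two_div {a R ρ : ℝ} (ha : a ≠ 0) (hR : 0 ≤ R) (hρ : 0 ≤ ρ) :
    (R ^ a * ρ) ^ (2 / a) = R ^ 2 * ρ ^ (2 / a) := by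
  rw [Real.mul_rpow (Real.rpow_nonneg hR _) hρ, ← Real.rpow_mul hR, mul_div_cancel₀ _ ha,
    Real.rpow_two]

theorem exists_cover_cantorStage (P : ℕ → DiskPacking) {a : ℝ} (ha : 1 ≤ a) (N k : ℕ) :
    ∃ (ι : Type) (_ : Fintype ι) (c : ι → ℂ) (ρ : ι → ℝ), (∀ i, 0 ≤ ρ i ∧ ρ i ≤ (1 / 2) ^ N) ∧
      cantorStage P a N k ⊆ ⋃ i, closedBall (c i) (ρ i) ∧ ∑ i, ρ i ^ (2 / a) ≤ 1 := by
  induction N generalizing k with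
  | zero =>
    exact ⟨Unit, inferInstance, fun _ => 0, fun _ => 1, by simp,
      subset_iUnion (fun _ : Unit => closedBall (0 : ℂ) 1) (), by simp⟩
  | succ N ih =>
    obtain ⟨ι, _, c, ρ, hρ, hcover, hsum⟩ := ih (k + 1)
    refine ⟨(P k).disks × ι, inferInstance, fun i => diskEmbed a i.1 (c i.2),
      fun i => i.1.1.2 ^ a * ρ i.2, fun ⟨p, i⟩ => ⟨?_, ?_⟩, ?_, ?_⟩
    · exact mul_nonneg ((P k).rpow_pos a p.2).le (hρ i).1
    · rw [pow_succ']
      exact mul_le_mul (((P k).rpow_le ha p.2).trans ((P k).le_half _ p.2)) (hρ i).2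
        (hρ i).1 one_half_pos.le
    · refine iUnion₂_subset fun p hp => image_subset_iff.2 fun z hz => ?_
      obtain ⟨i, hi⟩ := mem_iUnion.1 (hcover hz)
      refine mem_iUnion.2 ⟨(⟨p, hp⟩, i), ?_⟩
      rw [mem_closedBall_iff_norm] at hi ⊢
      rw [norm_diskEmbed_sub_diskEmbed ((P k).pos p hp).le]
      exact mul_le_mul_of_nonneg_left hi ((P k).rpow_pos a hp).le
    · calc ∑ i : (P k).disks × ι, (i.1.1.2 ^ a * ρ i.2) ^ (2 / a)
          = ∑ p : (P k).disks, ∑ i, p.1.2 ^ 2 * ρ i ^ (2 / a) := by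
            rw [Fintype.sum_prod_type]
            exact Finset.sum_congr rfl fun p _ => Finset.sum_congr rfl fun i _ =>
              rpow_mul_rpow_two_div (by positivity) ((P k).pos _ p.2).le (hρ i).1
        _ = (∑ p ∈ (P k).disks, p.2 ^ 2) * ∑ i, ρ i ^ (2 / a) := by
            rw [Finset.sum_mul_sum, Finset.sum_coe_sort (P k).disks
              fun p => ∑ i, p.2 ^ 2 * ρ i ^ (2 / a)]
        _ ≤ 1 := mul_le_one₀ (P k).sum_sq_le_one
            (Finset.sum_nonneg fun i _ => Real.rpow_nonneg (hρ i).1 _) hsum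

theorem hausdorffMeasure_packingCantor_lt_top (P : ℕ → DiskPacking) {a : ℝ} (ha : 1 ≤ a) :
    μH[2 / a] (packingCantor P a) < ⊤ := by
  refine (hausdorffMeasure_le_of_forall_exists_cover (C := 1) (by positivity)
    fun δ hδ => ?_).trans_lt ENNReal.ofReal_lt_top
  obtain ⟨N, hN⟩ := exists_pow_lt_of_lt_one hδ one_half_lt_one
  obtain ⟨ι, hι, c, ρ, hρ, hcover, hsum⟩ := exists_cover_cantorStage P ha N 0
  exact ⟨ι, hι, c, ρ, fun i => ⟨(hρ i).1, (hρ i).2.trans hN.le⟩,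
    (iInter_subset _ N).trans hcover, hsum⟩

/-- The packings `P k` miss so little area of the unit disk that the product of the proportions
`∑ R ^ 2` of the area which they cover is positive. -/
def IsAreaFilling (P : ℕ → DiskPacking) : Prop :=
  ∀ k : ℕ, 1 - 1 / ((k : ℝ) + 2) ^ 2 ≤ ∑ p ∈ (P k).disks, p.2 ^ 2

theorem exists_isAreaFilling_rpow_le_half {b : ℝ} (hb : 1 < b) :
    ∃ P : ℕ → DiskPacking, IsAreaFilling P ∧ ∀ k, ∀ p ∈ (P k).disks, p.2 ^ b ≤ p.2 / 2 := by
  have hδ : (0 : ℝ) < (1 / 2) ^ (b - 1)⁻¹ := by positivity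
  choose P hPδ hP using fun k : ℕ => DiskPacking.exists_one_sub_le_sum_sq hδ
    (show 0 < 1 / ((k : ℝ) + 2) ^ 2 by positivity)
  refine ⟨P, hP, fun k p hp => ?_⟩
  have hp0 := (P k).pos p hp
  calc p.2 ^ b = p.2 * p.2 ^ (b - 1) := by
        rw [← Real.rpow_one_add' hp0.le (by linarith), add_sub_cancel]
    _ ≤ p.2 * ((1 / 2) ^ (b - 1)⁻¹) ^ (b - 1) := by
        have := hPδ k p hp
        gcongr
    _ = p.2 / 2 := by
        rw [← Real.rpow_mul one_half_pos.le, inv_mul_cancel₀ (by linarith), Real.rpow_one]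
        ring

theorem DiskPacking.pairwiseDisjoint_image_diskEmbed (P : DiskPacking) {a : ℝ} (ha : 1 ≤ a)
    {s : Set ℂ} (hs : s ⊆ closedBall 0 1) :
    (P.disks : Set (ℂ × ℝ)).PairwiseDisjoint fun p => diskEmbed a p '' s :=
  P.pairwiseDisjoint.mono_on fun _ hp => image_subset_iff.2 fun _ hz =>
    P.diskEmbed_mem_closedBall ha hp (by simpa using hs hz)

theorem IsAreaFilling.le_volume_cantorStage_one {P : ℕ → DiskPacking} (hP : IsAreaFilling P)
    (N k : ℕ) : ENNReal.ofReal ((k + 1) / (k + 2)) ≤ volume (cantorStage P 1 N k) := by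
  induction N generalizing k with
  | zero =>
    calc ENNReal.ofReal (((k : ℝ) + 1) / (k + 2)) ≤ 1 := by
          rw [ENNReal.ofReal_le_one, div_le_one (by positivity)]
          linarith
      _ ≤ NNReal.pi := by
          rw [ENNReal.one_le_coe_iff, ← NNReal.coe_le_coe]
          exact_mod_cast (by norm_num : (1 : ℝ) ≤ 3).trans Real.pi_gt_three.le
      _ = volume (cantorStage P 1 0 k) := by
          rw [cantorStage, Complex.volume_closedBall, ENNReal.ofReal_one, one_pow, one_mul]
  | succ N ih =>
    calc ENNReal.ofReal (((k : ℝ) + 1) / (k + 2))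
        = ENNReal.ofReal (1 - 1 / ((k : ℝ) + 2) ^ 2) *
            ENNReal.ofReal (((k + 1 : ℕ) + 1) / ((k + 1 : ℕ) + 2)) := by
          rw [← ENNReal.ofReal_mul' (by positivity)]
          congr 1
          push_cast
          field_simp
          ring
      _ ≤ ENNReal.ofReal (∑ p ∈ (P k).disks, p.2 ^ 2) * volume (cantorStage P 1 N (k + 1)) :=
          mul_le_mul' (ENNReal.ofReal_le_ofReal (hP k)) (ih (k + 1))
      _ = volume (cantorStage P 1 (N + 1) k) := by
          rw [cantorStage, measure_biUnion_finset ((P k).pairwiseDisjoint_image_diskEmbed le_rfl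
            (cantorStage_subset_closedBall P le_rfl N (k + 1))) fun p _ =>
            ((isCompact_cantorStage P 1 N (k + 1)).image (continuous_diskEmbed 1 p)).measurableSet,
            ENNReal.ofReal_sum_of_nonneg fun _ _ => sq_nonneg _, Finset.sum_mul]
          simp only [volume_image_diskEmbed, Real.rpow_one]

theorem IsAreaFilling.volume_packingCantor_one_pos {P : ℕ → DiskPacking} (hP : IsAreaFilling P) :
    0 < volume (packingCantor P 1) := by
  have hlim := tendsto_measure_iInter_atTop (μ := volume) (s := fun N => cantorStage P 1 N 0)
    (fun N => (isCompact_cantorStage P 1 N 0).measurableSet.nullMeasurableSet)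
    (antitone_cantorStage P le_rfl 0) ⟨0, (isCompact_cantorStage P 1 0 0).measure_lt_top.ne⟩
  refine lt_of_lt_of_le ?_ (ge_of_tendsto' hlim fun N => hP.le_volume_cantorStage_one N 0)
  rw [ENNReal.ofReal_pos]
  norm_num

theorem volume_le_hausdorffMeasure_two (s : Set ℂ) : volume s ≤ μH[2] s := by
  have hs : volume s = volume (Complex.measurableEquivRealProd '' s) := by
    rw [MeasurableEquiv.image_eq_preimage_symm]
    exact ((Complex.volume_preserving_equiv_real_prod.symm).measure_preimage_equiv s).symm
  have hLip : LipschitzWith 1 Complex.measurableEquivRealProd := by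
    refine LipschitzWith.of_dist_le_mul fun x y => ?_
    rw [NNReal.coe_one, one_mul, dist_eq_norm x y, Prod.dist_eq]
    refine max_le ?_ ?_
    · simpa [Real.dist_eq] using Complex.abs_re_le_norm (x - y)
    · simpa [Real.dist_eq] using Complex.abs_im_le_norm (x - y)
  rw [hs, ← hausdorffMeasure_prod_real]
  simpa using hLip.hausdorffMeasure_image_le (d := 2) zero_le_two s

/-! ### Hölder correspondence of the Cantor sets -/

/-- Pairs of points of the `N`-th stages for the exponents `a` and `b` which lie in disks with the
same address, that is, which are obtained from the same choice of disks of the packings. -/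
noncomputable def addressPairs (P : ℕ → DiskPacking) (a b : ℝ) : ℕ → ℕ → Set (ℂ × ℂ)
  | 0, _ => closedBall 0 1 ×ˢ closedBall 0 1
  | N + 1, k => ⋃ p ∈ (P k).disks,
      Prod.map (diskEmbed a p) (diskEmbed b p) '' addressPairs P a b N (k + 1)

theorem isCompact_addressPairs (P : ℕ → DiskPacking) (a b : ℝ) (N k : ℕ) :
    IsCompact (addressPairs P a b N k) := by
  induction N generalizing k with
  | zero => exact (isCompact_closedBall _ _).prod (isCompact_closedBall _ _)
  | succ N ih =>
    exact (P k).disks.isCompact_biUnion fun p _ =>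
      (ih (k + 1)).image ((continuous_diskEmbed a p).prodMap (continuous_diskEmbed b p))

theorem addressPairs_subset_prod (P : ℕ → DiskPacking) (a b : ℝ) (N k : ℕ) :
    addressPairs P a b N k ⊆ cantorStage P a N k ×ˢ cantorStage P b N k := by
  induction N generalizing k with
  | zero => exact subset_rfl
  | succ N ih =>
    refine iUnion₂_subset fun p hp => image_subset_iff.2 fun z hz => ?_
    exact ⟨mem_biUnion hp (mem_image_of_mem _ (ih (k + 1) hz).1),
      mem_biUnion hp (mem_image_of_mem _ (ih (k + 1) hz).2)⟩

theorem norm_le_one_of_mem_addressPairs (P : ℕ → DiskPacking) {a b : ℝ} (ha : 1 ≤ a) (hb : 1 ≤ b)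
    {N k : ℕ} {z : ℂ × ℂ} (hz : z ∈ addressPairs P a b N k) : ‖z.1‖ ≤ 1 ∧ ‖z.2‖ ≤ 1 := by
  have h := addressPairs_subset_prod P a b N k hz
  exact ⟨mem_closedBall_zero_iff.1 (cantorStage_subset_closedBall P ha N k h.1),
    mem_closedBall_zero_iff.1 (cantorStage_subset_closedBall P hb N k h.2)⟩

theorem swap_mem_addressPairs (P : ℕ → DiskPacking) {a b : ℝ} {N k : ℕ} {z : ℂ × ℂ}
    (hz : z ∈ addressPairs P a b N k) : z.swap ∈ addressPairs P b a N k := by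
  induction N generalizing k z with
  | zero => exact ⟨hz.2, hz.1⟩
  | succ N ih =>
    obtain ⟨p, hp, w, hw, rfl⟩ := mem_iUnion₂.1 hz
    exact mem_iUnion₂.2 ⟨p, hp, w.swap, ih hw, rfl⟩

theorem exists_mem_addressPairs (P : ℕ → DiskPacking) (a b : ℝ) {N k : ℕ} {x : ℂ}
    (hx : x ∈ cantorStage P a N k) : ∃ y, (x, y) ∈ addressPairs P a b N k := by
  induction N generalizing k x with
  | zero => exact ⟨0, hx, by simp⟩
  | succ N ih =>
    obtain ⟨p, hp, w, hw, rfl⟩ := mem_iUnion₂.1 hx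
    obtain ⟨y, hy⟩ := ih hw
    exact ⟨diskEmbed b p y, mem_iUnion₂.2 ⟨p, hp, (w, y), hy, rfl⟩⟩

theorem addressPairs_succ_subset (P : ℕ → DiskPacking) {a b : ℝ} (ha : 1 ≤ a) (hb : 1 ≤ b)
    (N k : ℕ) : addressPairs P a b (N + 1) k ⊆ addressPairs P a b N k := by
  induction N generalizing k with
  | zero =>
    exact fun z hz => by simpa [addressPairs] using norm_le_one_of_mem_addressPairs P ha hb hz
  | succ N ih => exact iUnion₂_mono fun p _ => image_mono (ih (k + 1))

theorem exists_forall_mem_addressPairs (P : ℕ → DiskPacking) {a b : ℝ} (ha : 1 ≤ a) (hb : 1 ≤ b)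
    {x : ℂ} (hx : x ∈ packingCantor P a) : ∃ y, ∀ N, (x, y) ∈ addressPairs P a b N 0 := by
  have hclosed : IsClosed {z : ℂ × ℂ | z.1 = x} := isClosed_eq continuous_fst continuous_const
  obtain ⟨z, hz⟩ := IsCompact.nonempty_iInter_of_sequence_nonempty_isCompact_isClosed
    (fun N => addressPairs P a b N 0 ∩ {z | z.1 = x})
    (fun N => inter_subset_inter_left _ (addressPairs_succ_subset P ha hb N 0))
    (fun N =>
      have ⟨_, hy⟩ := exists_mem_addressPairs P a b (mem_iInter.1 hx N)
      ⟨_, hy, rfl⟩)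
    ((isCompact_addressPairs P a b 0 0).inter_right hclosed)
    (fun N => (isCompact_addressPairs P a b N 0).isClosed.inter hclosed)
  have hzN := mem_iInter.1 hz
  have hzx : z.1 = x := (hzN 0).2
  exact ⟨z.2, fun N => hzx ▸ (hzN N).1⟩

theorem DiskPacking.norm_diskEmbed_sub_diskEmbed_le (P : DiskPacking) {b : ℝ} (hb : 1 ≤ b)
    {p q : ℂ × ℝ} (hp : p ∈ P.disks) (hq : q ∈ P.disks) (hpq : p ≠ q) {z w : ℂ} (hz : ‖z‖ ≤ 1)
    (hw : ‖w‖ ≤ 1) : ‖diskEmbed b p z - diskEmbed b q w‖ ≤ 2 * ‖p.1 - q.1‖ := by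
  have hz' := mem_closedBall_iff_norm.1 (P.diskEmbed_mem_closedBall hb hp hz)
  have hw' := mem_closedBall_iff_norm.1 (P.diskEmbed_mem_closedBall hb hq hw)
  calc ‖diskEmbed b p z - diskEmbed b q w‖
      = ‖(diskEmbed b p z - p.1) + (p.1 - q.1) - (diskEmbed b q w - q.1)‖ := by congr 1; ring
    _ ≤ ‖diskEmbed b p z - p.1‖ + ‖p.1 - q.1‖ + ‖diskEmbed b q w - q.1‖ :=
      (norm_sub_le _ _).trans (by gcongr; exact norm_add_le _ _)
    _ ≤ 2 * ‖p.1 - q.1‖ := by linarith [P.add_lt_norm p hp q hq hpq]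

theorem DiskPacking.half_norm_sub_le_norm_diskEmbed_sub_diskEmbed (P : DiskPacking) {a : ℝ}
    (hP : ∀ p ∈ P.disks, p.2 ^ a ≤ p.2 / 2) {p q : ℂ × ℝ} (hp : p ∈ P.disks) (hq : q ∈ P.disks)
    (hpq : p ≠ q) {z w : ℂ} (hz : ‖z‖ ≤ 1) (hw : ‖w‖ ≤ 1) :
    ‖p.1 - q.1‖ / 2 ≤ ‖diskEmbed a p z - diskEmbed a q w‖ := by
  have hz' : ‖diskEmbed a p z - p.1‖ ≤ p.2 / 2 := by
    rw [norm_diskEmbed_sub (P.pos p hp).le]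
    exact (mul_le_of_le_one_right (P.rpow_pos a hp).le hz).trans (hP p hp)
  have hw' : ‖diskEmbed a q w - q.1‖ ≤ q.2 / 2 := by
    rw [norm_diskEmbed_sub (P.pos q hq).le]
    exact (mul_le_of_le_one_right (P.rpow_pos a hq).le hw).trans (hP q hq)
  have htri : ‖p.1 - q.1‖ ≤ ‖diskEmbed a p z - diskEmbed a q w‖ + ‖diskEmbed a p z - p.1‖ +
      ‖diskEmbed a q w - q.1‖ :=
    calc ‖p.1 - q.1‖ = ‖(diskEmbed a p z - diskEmbed a q w) - (diskEmbed a p z - p.1) +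
          (diskEmbed a q w - q.1)‖ := by congr 1; ring
      _ ≤ _ := (norm_add_le _ _).trans (by gcongr; exact norm_sub_le _ _)
  linarith [P.add_lt_norm p hp q hq hpq]

theorem DiskPacking.norm_diskEmbed_sub_le_rpow (P : DiskPacking) {a b : ℝ} (hb : 1 ≤ b)
    (hba : b ≤ a) (hP : ∀ p ∈ P.disks, p.2 ^ a ≤ p.2 / 2) {p q : ℂ × ℝ} (hp : p ∈ P.disks)
    (hq : q ∈ P.disks) (hpq : p ≠ q) {z w : ℂ × ℂ} (hz : ‖z.1‖ ≤ 1 ∧ ‖z.2‖ ≤ 1)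
    (hw : ‖w.1‖ ≤ 1 ∧ ‖w.2‖ ≤ 1) :
    ‖diskEmbed b p z.2 - diskEmbed b q w.2‖ ≤
      4 * ‖diskEmbed a p z.1 - diskEmbed a q w.1‖ ^ (b / a) := by
  have ha0 : 0 < a := by linarith
  have hcentres : ‖p.1 - q.1‖ / 2 ≤ 1 := by
    linarith [norm_sub_le p.1 q.1, P.norm_add_radius_le p hp, P.norm_add_radius_le q hq,
      P.pos p hp, P.pos q hq]
  calc ‖diskEmbed b p z.2 - diskEmbed b q w.2‖ ≤ 2 * ‖p.1 - q.1‖ :=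
        P.norm_diskEmbed_sub_diskEmbed_le hb hp hq hpq hz.2 hw.2
    _ = 4 * (‖p.1 - q.1‖ / 2) := by ring
    _ ≤ 4 * (‖p.1 - q.1‖ / 2) ^ (b / a) := by
        gcongr
        exact Real.self_le_rpow_of_le_one (by positivity) hcentres ((div_le_one ha0).2 hba)
    _ ≤ 4 * ‖diskEmbed a p z.1 - diskEmbed a q w.1‖ ^ (b / a) := by
        have := P.half_norm_sub_le_norm_diskEmbed_sub_diskEmbed hP hp hq hpq hz.1 hw.1
        gcongr

theorem norm_sub_le_of_mem_addressPairs (P : ℕ → DiskPacking) {a b : ℝ} (hb : 1 ≤ b) (hba : b ≤ a)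
    (hP : ∀ k, ∀ p ∈ (P k).disks, p.2 ^ a ≤ p.2 / 2) {N k : ℕ} {z w : ℂ × ℂ}
    (hz : z ∈ addressPairs P a b N k) (hw : w ∈ addressPairs P a b N k) :
    ‖z.2 - w.2‖ ≤ 4 * ‖z.1 - w.1‖ ^ (b / a) + 2 * (1 / 2) ^ N := by
  have ha : 1 ≤ a := hb.trans hba
  induction N generalizing k z w with
  | zero =>
    have hz1 := (norm_le_one_of_mem_addressPairs P ha hb hz).2
    have hw1 := (norm_le_one_of_mem_addressPairs P ha hb hw).2
    calc ‖z.2 - w.2‖ ≤ 0 + 2 * (1 / 2) ^ 0 := by linarith [norm_sub_le z.2 w.2]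
      _ ≤ _ := by gcongr; positivity
  | succ N ih =>
    obtain ⟨p, hp, z', hz', rfl⟩ := mem_iUnion₂.1 hz
    obtain ⟨q, hq, w', hw', rfl⟩ := mem_iUnion₂.1 hw
    simp only [Prod.map_fst, Prod.map_snd]
    rcases eq_or_ne p q with rfl | hpq
    · have hp0 := ((P k).pos p hp).le
      have hpb := (P k).rpow_pos b hp
      have hpb_half := ((P k).rpow_le hb hp).trans ((P k).le_half p hp)
      rw [norm_diskEmbed_sub_diskEmbed hp0, norm_diskEmbed_sub_diskEmbed hp0,
        Real.mul_rpow (by positivity) (norm_nonneg _), ← Real.rpow_mul hp0,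
        mul_div_cancel₀ _ (by linarith : a ≠ 0)]
      calc p.2 ^ b * ‖z'.2 - w'.2‖
          ≤ p.2 ^ b * (4 * ‖z'.1 - w'.1‖ ^ (b / a) + 2 * (1 / 2) ^ N) := by
            gcongr; exact ih hz' hw'
        _ = 4 * (p.2 ^ b * ‖z'.1 - w'.1‖ ^ (b / a)) + p.2 ^ b * (2 * (1 / 2) ^ N) := by ring
        _ ≤ 4 * (p.2 ^ b * ‖z'.1 - w'.1‖ ^ (b / a)) + 1 / 2 * (2 * (1 / 2) ^ N) := by gcongr
        _ = _ := by ring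
    · have := (P k).norm_diskEmbed_sub_le_rpow hb hba (hP k) hp hq hpq
        (norm_le_one_of_mem_addressPairs P ha hb hz') (norm_le_one_of_mem_addressPairs P ha hb hw')
      have : (0 : ℝ) ≤ 2 * (1 / 2) ^ (N + 1) := by positivity
      linarith

theorem norm_sub_le_of_forall_mem_addressPairs (P : ℕ → DiskPacking) {a b : ℝ} (hb : 1 ≤ b)
    (hba : b ≤ a) (hP : ∀ k, ∀ p ∈ (P k).disks, p.2 ^ a ≤ p.2 / 2) {x y x' y' : ℂ}
    (h : ∀ N, (x, y) ∈ addressPairs P a b N 0) (h' : ∀ N, (x', y') ∈ addressPairs P a b N 0) :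
    ‖y - y'‖ ≤ 4 * ‖x - x'‖ ^ (b / a) := by
  have hlim : Tendsto (fun N : ℕ => 4 * ‖x - x'‖ ^ (b / a) + 2 * (1 / 2 : ℝ) ^ N) atTop
      (𝓝 (4 * ‖x - x'‖ ^ (b / a) + 2 * 0)) :=
    ((tendsto_pow_atTop_nhds_zero_of_lt_one (by norm_num) one_half_lt_one).const_mul 2).const_add _
  rw [mul_zero, add_zero] at hlim
  exact ge_of_tendsto' hlim fun N => norm_sub_le_of_mem_addressPairs P hb hba hP (h N) (h' N)

theorem exists_holderOnWith_packingCantor (P : ℕ → DiskPacking) {a b : ℝ} (hb : 1 ≤ b)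
    (hba : b ≤ a) (hP : ∀ k, ∀ p ∈ (P k).disks, p.2 ^ a ≤ p.2 / 2) :
    ∃ f : ℂ → ℂ, HolderOnWith 4 (b / a).toNNReal f (packingCantor P a) ∧
      packingCantor P b ⊆ f '' packingCantor P a := by
  have ha : 1 ≤ a := hb.trans hba
  have hba0 : 0 < b / a := by positivity
  choose! f hf using fun x => exists_forall_mem_addressPairs (x := x) P ha hb
  refine ⟨f, fun x hx x' hx' => ?_, fun y hy => ?_⟩
  · rw [edist_dist, edist_dist, Real.coe_toNNReal _ hba0.le,
      ENNReal.ofReal_rpow_of_nonneg dist_nonneg hba0.le, dist_eq_norm, dist_eq_norm,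
      show ((4 : NNReal) : ℝ≥0∞) = ENNReal.ofReal 4 by simp, ← ENNReal.ofReal_mul (by norm_num)]
    exact ENNReal.ofReal_le_ofReal
      (norm_sub_le_of_forall_mem_addressPairs P hb hba hP (hf x hx) (hf x' hx'))
  · obtain ⟨x, hyx⟩ := exists_forall_mem_addressPairs P hb ha hy
    have hxy : ∀ N, (x, y) ∈ addressPairs P a b N 0 := fun N => swap_mem_addressPairs P (hyx N)
    have hx : x ∈ packingCantor P a :=
      mem_iInter.2 fun N => (addressPairs_subset_prod P a b N 0 (hxy N)).1
    have hdist := norm_sub_le_of_forall_mem_addressPairs P hb hba hP (hf x hx) hxy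
    rw [sub_self, norm_zero, Real.zero_rpow hba0.ne', mul_zero] at hdist
    exact ⟨x, hx, sub_eq_zero.1 (norm_le_zero_iff.1 hdist)⟩

theorem IsAreaFilling.hausdorffMeasure_packingCantor_pos {P : ℕ → DiskPacking}
    (hP : IsAreaFilling P) {a : ℝ} (ha : 1 ≤ a)
    (hPa : ∀ k, ∀ p ∈ (P k).disks, p.2 ^ a ≤ p.2 / 2) : 0 < μH[2 / a] (packingCantor P a) := by
  obtain ⟨f, hf, hsurj⟩ := exists_holderOnWith_packingCantor P le_rfl ha hPa
  have hHolder := hf.hausdorffMeasure_image_le (Real.toNNReal_pos.2 (by positivity)) (d := 2)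
    zero_le_two
  rw [Real.coe_toNNReal _ (by positivity), one_div_mul_eq_div] at hHolder
  refine pos_of_mul_pos_right (lt_of_lt_of_le ?_ hHolder) zero_le
  calc 0 < volume (packingCantor P 1) := hP.volume_packingCantor_one_pos
    _ ≤ μH[2] (packingCantor P 1) := volume_le_hausdorffMeasure_two _
    _ ≤ μH[2] (f '' packingCantor P a) := measure_mono hsurj

/-! ### Radial stretchings and the limit map -/

theorem lipschitzWith_smul_of_forall_le_norm {E : Type*} [SeminormedAddCommGroup E]
    [NormedSpace ℝ E] {g : E → ℝ} {L M R : NNReal} (hg : LipschitzWith L g) (hM : ∀ z, ‖g z‖ ≤ M)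
    (hR : ∀ z w, R ≤ ‖z‖ → R ≤ ‖w‖ → g z = g w) :
    LipschitzWith (M + L * R) fun z => g z • z := by
  refine LipschitzWith.of_dist_le_mul fun z w => ?_
  wlog hwz : ‖w‖ ≤ ‖z‖ generalizing z w
  · simpa only [dist_comm] using this w z (le_of_not_ge hwz)
  have hdiff : ‖(g z - g w) • w‖ ≤ L * R * ‖z - w‖ := by
    rcases le_total (R : ℝ) ‖w‖ with hw | hw
    · rw [hR z w (hw.trans hwz) hw, sub_self, zero_smul, norm_zero]
      positivity
    · rw [norm_smul, mul_right_comm]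
      exact mul_le_mul (hg.norm_sub_le z w) hw (norm_nonneg _) (by positivity)
  calc dist (g z • z) (g w • w) = ‖g z • (z - w) + (g z - g w) • w‖ := by
        rw [dist_eq_norm, smul_sub, sub_smul, sub_add_sub_cancel]
    _ ≤ M * ‖z - w‖ + L * R * ‖z - w‖ := by
        refine (norm_add_le _ _).trans (add_le_add ?_ hdiff)
        rw [norm_smul]
        exact mul_le_mul_of_nonneg_right (hM z) (norm_nonneg _)
    _ = ↑(M + L * R) * dist z w := by
        rw [dist_eq_norm]
        push_cast
        ring

/-- The radial map which is a homothety from the ball of radius `R ^ a` onto the ball of radius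
`R ^ b`, a radial power map from the annulus `R ^ a ≤ ‖z‖ ≤ R` onto the annulus
`R ^ b ≤ ‖z‖ ≤ R`, and the identity for `R ≤ ‖z‖`. -/
noncomputable def radialStretch {E : Type*} [NormedAddCommGroup E] [NormedSpace ℝ E]
    (R a b : ℝ) (z : E) : E :=
  ((max (R ^ a) (min R ‖z‖) / R) ^ ((b - a) / (a - 1)) : ℝ) • z

namespace radialStretch

variable {E : Type*} [NormedAddCommGroup E] [NormedSpace ℝ E] {R a b : ℝ} {z : E}

theorem eq_self (hR : 0 < R) (haR : R ^ a ≤ R) (hz : R ≤ ‖z‖) : radialStretch R a b z = z := by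
  rw [radialStretch, min_eq_left hz, max_eq_right haR, div_self hR.ne', Real.one_rpow, one_smul]

theorem eq_smul_of_le (hR : 0 < R) (haR : R ^ a ≤ R) (ha : a ≠ 1) (hz : ‖z‖ ≤ R ^ a) :
    radialStretch R a b z = (R ^ (b - a) : ℝ) • z := by
  rw [radialStretch, min_eq_right (hz.trans haR), max_eq_left hz, ← Real.rpow_sub_one hR.ne',
    ← Real.rpow_mul hR.le, mul_div_cancel₀ _ (sub_ne_zero.2 ha)]

theorem eq_smul_of_mem_Icc (hz : ‖z‖ ∈ Icc (R ^ a) R) :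
    radialStretch R a b z = ((‖z‖ / R) ^ ((b - a) / (a - 1)) : ℝ) • z := by
  rw [radialStretch, min_eq_right hz.2, max_eq_right hz.1]

theorem norm_of_mem_Icc (hR : 0 < R) (ha : a ≠ 1) (hz : ‖z‖ ∈ Icc (R ^ a) R) :
    ‖radialStretch R a b z‖ = R * (‖z‖ / R) ^ ((b - 1) / (a - 1)) := by
  have hz0 : 0 < ‖z‖ := (Real.rpow_pos_of_pos hR a).trans_le hz.1
  have ha' := sub_ne_zero.2 ha
  have hexp : (b - 1) / (a - 1) = (b - a) / (a - 1) + 1 := by field_simp; ring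
  rw [eq_smul_of_mem_Icc hz, norm_smul, Real.norm_of_nonneg (by positivity), hexp,
    Real.rpow_add_one (by positivity)]
  field_simp

theorem norm_mem_Icc (hR : 0 < R) (ha : 1 < a) (hb : 1 < b) (hz : ‖z‖ ∈ Icc (R ^ a) R) :
    ‖radialStretch R a b z‖ ∈ Icc (R ^ b) R := by
  have hexp : 0 ≤ (b - 1) / (a - 1) := div_nonneg (sub_pos.2 hb).le (sub_pos.2 ha).le
  rw [norm_of_mem_Icc hR ha.ne' hz]
  refine ⟨?_, mul_le_of_le_one_right hR.le
    (Real.rpow_le_one (by positivity) ((div_le_one hR).2 hz.2) hexp)⟩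
  calc R ^ b = R * (R ^ a / R) ^ ((b - 1) / (a - 1)) := by
        rw [← Real.rpow_sub_one hR.ne', ← Real.rpow_mul hR.le,
          mul_div_cancel₀ _ (sub_pos.2 ha).ne', ← Real.rpow_one_add' hR.le (by linarith),
          add_sub_cancel]
    _ ≤ R * (‖z‖ / R) ^ ((b - 1) / (a - 1)) := by
        have := hz.1
        gcongr

theorem leftInverse (hR : 0 < R) (hR1 : R ≤ 1) (ha : 1 < a) (hb : 1 < b) :
    Function.LeftInverse (radialStretch R b a) (radialStretch (E := E) R a b) := by
  intro z
  have haR := Real.rpow_le_self_of_le_one hR.le hR1 ha.le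
  have hbR := Real.rpow_le_self_of_le_one hR.le hR1 hb.le
  rcases le_total ‖z‖ (R ^ a) with hz | hz
  · have hz' : ‖(R ^ (b - a) : ℝ) • z‖ ≤ R ^ b := by
      rw [norm_smul, Real.norm_of_nonneg (by positivity), ← sub_add_cancel b a, Real.rpow_add hR,
        sub_add_cancel]
      gcongr
    rw [eq_smul_of_le hR haR ha.ne' hz, eq_smul_of_le hR hbR hb.ne' hz', smul_smul,
      ← Real.rpow_add hR, sub_add_sub_cancel, sub_self, Real.rpow_zero, one_smul]
  rcases le_total ‖z‖ R with hz' | hz'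
  · have hz0 : 0 < ‖z‖ / R := div_pos ((Real.rpow_pos_of_pos hR a).trans_le hz) hR
    have ha' := (sub_pos.2 ha).ne'
    have hb' := (sub_pos.2 hb).ne'
    have hexp : (b - 1) / (a - 1) * ((a - b) / (b - 1)) + (b - a) / (a - 1) = 0 := by
      field_simp
      ring
    rw [eq_smul_of_mem_Icc (norm_mem_Icc hR ha hb ⟨hz, hz'⟩), norm_of_mem_Icc hR ha.ne' ⟨hz, hz'⟩,
      eq_smul_of_mem_Icc ⟨hz, hz'⟩, smul_smul, mul_div_cancel_left₀ _ hR.ne',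
      ← Real.rpow_mul hz0.le, ← Real.rpow_add hz0, hexp, Real.rpow_zero, one_smul]
  · rw [eq_self hR haR hz', eq_self hR hbR hz']

theorem exists_lipschitzWith (hR : 0 < R) (haR : R ^ a ≤ R) :
    ∃ C, LipschitzWith C (radialStretch (E := E) R a b) := by
  set f : ℝ → ℝ := fun t => (t / R) ^ ((b - a) / (a - 1)) with hf
  have hcd : ContDiffOn ℝ 1 f (Icc (R ^ a) R) :=
    (contDiffOn_id.div_const R).rpow_const_of_ne fun t ht =>
      (div_pos ((Real.rpow_pos_of_pos hR a).trans_le ht.1) hR).ne'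
  obtain ⟨L, hL⟩ := hcd.exists_lipschitzOnWith one_ne_zero (convex_Icc _ _) isCompact_Icc
  obtain ⟨M, hM⟩ := isCompact_Icc.exists_bound_of_continuousOn hcd.continuousOn
  let g : E → ℝ := fun z => f (projIcc (R ^ a) R haR ‖z‖)
  have hg : LipschitzWith (L * 1 * 1) g :=
    (hL.to_restrict.comp (LipschitzWith.projIcc haR)).comp lipschitzWith_one_norm
  have hgM : ∀ z, ‖g z‖ ≤ M.toNNReal := fun z => (hM _ (projIcc _ _ haR ‖z‖).2).trans
    (Real.le_coe_toNNReal M)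
  have hg_const : ∀ z w, R.toNNReal ≤ ‖z‖ → R.toNNReal ≤ ‖w‖ → g z = g w := by
    intro z w hz hw
    rw [Real.coe_toNNReal _ hR.le] at hz hw
    simp only [g, projIcc_of_right_le haR hz, projIcc_of_right_le haR hw]
  have heq : (fun z => g z • z) = radialStretch (E := E) R a b := by
    ext z
    simp only [g, hf, coe_projIcc, radialStretch]
  exact ⟨_, heq ▸ lipschitzWith_smul_of_forall_le_norm hg hgM hg_const⟩

end radialStretch

/-- Continuous maps of the plane which preserve the closed unit disk and fix its exterior. -/
structure IsDiskMap (ψ : ℂ → ℂ) : Prop where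
  continuous : Continuous ψ
  eq_self : ∀ z, 1 ≤ ‖z‖ → ψ z = z
  norm_le : ∀ z, ‖z‖ ≤ 1 → ‖ψ z‖ ≤ 1

theorem isDiskMap_id : IsDiskMap id := ⟨continuous_id, fun _ _ => rfl, fun _ h => h⟩

/-- The radial stretching of the disk of radius `R` centred at the origin, with a scaled copy of
`ψ` in the inner disk of radius `R ^ a`. -/
noncomputable def diskMap (R a b : ℝ) (ψ : ℂ → ℂ) (z : ℂ) : ℂ :=
  radialStretch R a b ((R ^ a : ℝ) • ψ ((R ^ a : ℝ)⁻¹ • z))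

section diskMap

variable {R a b : ℝ} {ψ : ℂ → ℂ}

theorem diskMap_smul (hψ : IsDiskMap ψ) (hR : 0 < R) (haR : R ^ a ≤ R) (ha : a ≠ 1) {w : ℂ}
    (hw : ‖w‖ ≤ 1) : diskMap R a b ψ ((R ^ a : ℝ) • w) = (R ^ b : ℝ) • ψ w := by
  have hRa := Real.rpow_pos_of_pos hR a
  have hle : ‖(R ^ a : ℝ) • ψ w‖ ≤ R ^ a := by
    rw [norm_smul, Real.norm_of_nonneg hRa.le]
    exact mul_le_of_le_one_right hRa.le (hψ.norm_le w hw)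
  rw [diskMap, inv_smul_smul₀ hRa.ne', radialStretch.eq_smul_of_le hR haR ha hle, smul_smul,
    ← Real.rpow_add hR, sub_add_cancel]

theorem diskMap_of_le_norm (hψ : IsDiskMap ψ) (hR : 0 < R) {z : ℂ} (hz : R ^ a ≤ ‖z‖) :
    diskMap R a b ψ z = radialStretch R a b z := by
  have hRa := Real.rpow_pos_of_pos hR a
  have hz' : 1 ≤ ‖(R ^ a : ℝ)⁻¹ • z‖ := by
    rwa [norm_smul, norm_inv, Real.norm_of_nonneg hRa.le, one_le_inv_mul₀ hRa]
  rw [diskMap, hψ.eq_self _ hz', smul_inv_smul₀ hRa.ne']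

end diskMap

/-- The map which is a translate of `diskMap R a b ψ` in each disk `(c, R)` of the packing and the
identity elsewhere. -/
noncomputable def glueDisks (P : DiskPacking) (a b : ℝ) (ψ : ℂ → ℂ) (z : ℂ) : ℂ :=
  z + ∑ p ∈ P.disks, (diskMap p.2 a b ψ (z - p.1) - (z - p.1))

section glueDisks

variable {P : DiskPacking} {a b : ℝ} {ψ χ : ℂ → ℂ} {p : ℂ × ℝ} {z : ℂ}

theorem DiskPacking.radius_le_norm_sub {q : ℂ × ℝ} (hp : p ∈ P.disks) (hq : q ∈ P.disks)
    (hqp : q ≠ p) (hz : ‖z - p.1‖ ≤ p.2) : q.2 ≤ ‖z - q.1‖ := by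
  have hdist : ‖q.1 - p.1‖ ≤ ‖z - p.1‖ + ‖z - q.1‖ := by
    simpa only [sub_sub_sub_cancel_left] using norm_sub_le (z - p.1) (z - q.1)
  linarith [P.add_lt_norm q hq p hp hqp]

theorem DiskPacking.mem_diskEmbed_or_mem_annulus_or_radius_le (P : DiskPacking) (a : ℝ) (z : ℂ) :
    (∃ p ∈ P.disks, ∃ w, ‖w‖ ≤ 1 ∧ z = diskEmbed a p w) ∨
      (∃ p ∈ P.disks, ‖z - p.1‖ ∈ Icc (p.2 ^ a) p.2) ∨ ∀ p ∈ P.disks, p.2 ≤ ‖z - p.1‖ := by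
  by_cases h : ∃ p ∈ P.disks, ‖z - p.1‖ ≤ p.2
  · obtain ⟨p, hp, hz⟩ := h
    have hpa := P.rpow_pos a hp
    rcases le_total (p.2 ^ a) ‖z - p.1‖ with hz' | hz'
    · exact .inr (.inl ⟨p, hp, hz', hz⟩)
    · refine .inl ⟨p, hp, (p.2 ^ a : ℝ)⁻¹ • (z - p.1), ?_, ?_⟩
      · rwa [norm_smul, norm_inv, Real.norm_of_nonneg hpa.le, inv_mul_le_one₀ hpa]
      · rw [diskEmbed, smul_inv_smul₀ hpa.ne', add_sub_cancel]
  · push Not at h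
    exact .inr (.inr fun p hp => (h p hp).le)

theorem diskMap_sub_eq_self (hψ : IsDiskMap ψ) (ha : 1 ≤ a) (hp : p ∈ P.disks)
    (hz : p.2 ≤ ‖z - p.1‖) : diskMap p.2 a b ψ (z - p.1) = z - p.1 := by
  rw [diskMap_of_le_norm hψ (P.pos p hp) ((P.rpow_le ha hp).trans hz),
    radialStretch.eq_self (P.pos p hp) (P.rpow_le ha hp) hz]

theorem glueDisks_of_norm_sub_le (hψ : IsDiskMap ψ) (ha : 1 ≤ a) (hp : p ∈ P.disks)
    (hz : ‖z - p.1‖ ≤ p.2) : glueDisks P a b ψ z = p.1 + diskMap p.2 a b ψ (z - p.1) := by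
  rw [glueDisks, Finset.sum_eq_single_of_mem p hp]
  · ring
  · intro q hq hqp
    rw [diskMap_sub_eq_self hψ ha hq (DiskPacking.radius_le_norm_sub hp hq hqp hz), sub_self]

theorem glueDisks_eq_self (hψ : IsDiskMap ψ) (ha : 1 ≤ a)
    (hz : ∀ p ∈ P.disks, p.2 ≤ ‖z - p.1‖) : glueDisks P a b ψ z = z := by
  rw [glueDisks, Finset.sum_eq_zero, add_zero]
  intro p hp
  rw [diskMap_sub_eq_self hψ ha hp (hz p hp), sub_self]

theorem glueDisks_eq_self_of_one_le_norm (hψ : IsDiskMap ψ) (ha : 1 ≤ a) (hz : 1 ≤ ‖z‖) :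
    glueDisks P a b ψ z = z :=
  glueDisks_eq_self hψ ha fun p hp => by
    linarith [P.norm_add_radius_le p hp, norm_sub_norm_le z p.1]

theorem glueDisks_diskEmbed (hψ : IsDiskMap ψ) (ha : 1 < a) (hp : p ∈ P.disks) {w : ℂ}
    (hw : ‖w‖ ≤ 1) : glueDisks P a b ψ (diskEmbed a p w) = diskEmbed b p (ψ w) := by
  have hmem := mem_closedBall_iff_norm.1 (P.diskEmbed_mem_closedBall ha.le hp hw)
  rw [glueDisks_of_norm_sub_le hψ ha.le hp hmem, diskEmbed, add_sub_cancel_left,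
    diskMap_smul hψ (P.pos p hp) (P.rpow_le ha.le hp) ha.ne' hw, diskEmbed]

theorem glueDisks_of_mem_annulus (hψ : IsDiskMap ψ) (ha : 1 ≤ a) (hp : p ∈ P.disks)
    (hz : ‖z - p.1‖ ∈ Icc (p.2 ^ a) p.2) :
    glueDisks P a b ψ z = p.1 + radialStretch p.2 a b (z - p.1) := by
  rw [glueDisks_of_norm_sub_le hψ ha hp hz.2, diskMap_of_le_norm hψ (P.pos p hp) hz.1]

theorem exists_lipschitzWith_glueDisks (ha : 1 ≤ a) (hψ : ∃ C, LipschitzWith C ψ) :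
    ∃ C, LipschitzWith C (glueDisks P a b ψ) := by
  classical
  obtain ⟨C, hC⟩ := hψ
  have hdisk : ∀ p ∈ P.disks, ∃ D, LipschitzWith D
      (fun z => diskMap p.2 a b ψ (z - p.1) - (z - p.1)) := fun p hp => by
    obtain ⟨L, hL⟩ :=
      radialStretch.exists_lipschitzWith (E := ℂ) (b := b) (P.pos p hp) (P.rpow_le ha hp)
    have hsub := LipschitzWith.id.sub (LipschitzWith.const p.1)
    exact ⟨_, ((hL.comp ((lipschitzWith_smul (p.2 ^ a : ℝ)).comp (hC.comp
      (lipschitzWith_smul (p.2 ^ a : ℝ)⁻¹)))).comp hsub).sub hsub⟩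
  have hsum : ∀ s ⊆ P.disks, ∃ D, LipschitzWith D
      (fun z => ∑ p ∈ s, (diskMap p.2 a b ψ (z - p.1) - (z - p.1))) := fun s => by
    induction s using Finset.induction_on with
    | empty => exact fun _ => ⟨0, by simp⟩
    | insert p s hps ih =>
      intro hs
      obtain ⟨D, hD⟩ := ih fun q hq => hs (Finset.mem_insert_of_mem hq)
      obtain ⟨D', hD'⟩ := hdisk p (hs (Finset.mem_insert_self _ _))
      simp only [Finset.sum_insert hps]
      exact ⟨_, hD'.add hD⟩
  obtain ⟨D, hD⟩ := hsum P.disks subset_rfl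
  exact ⟨_, LipschitzWith.id.add hD⟩

theorem continuous_glueDisks (ha : 1 ≤ a) (hψ : Continuous ψ) :
    Continuous (glueDisks P a b ψ) := by
  refine continuous_id.add (continuous_finsetSum _ fun p hp => ?_)
  obtain ⟨L, hL⟩ :=
    radialStretch.exists_lipschitzWith (E := ℂ) (b := b) (P.pos p hp) (P.rpow_le ha hp)
  have := hL.continuous
  unfold diskMap
  fun_prop

theorem isDiskMap_glueDisks (hψ : IsDiskMap ψ) (ha : 1 < a) (hb : 1 < b) :
    IsDiskMap (glueDisks P a b ψ) where
  continuous := continuous_glueDisks ha.le hψ.continuous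
  eq_self z hz := glueDisks_eq_self_of_one_le_norm hψ ha.le hz
  norm_le z hz := by
    rw [← mem_closedBall_zero_iff]
    rcases P.mem_diskEmbed_or_mem_annulus_or_radius_le a z with
      ⟨p, hp, w, hw, rfl⟩ | ⟨p, hp, hzp⟩ | hzP
    · rw [glueDisks_diskEmbed hψ ha hp hw]
      exact P.closedBall_subset hp (P.diskEmbed_mem_closedBall hb.le hp (hψ.norm_le w hw))
    · rw [glueDisks_of_mem_annulus hψ ha.le hp hzp]
      refine P.closedBall_subset hp ?_
      rw [mem_closedBall_iff_norm, add_sub_cancel_left]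
      exact (radialStretch.norm_mem_Icc (P.pos p hp) ha hb hzp).2
    · rwa [glueDisks_eq_self hψ ha.le hzP, mem_closedBall_zero_iff]

theorem leftInverse_glueDisks (hψ : IsDiskMap ψ) (hχ : IsDiskMap χ)
    (hχψ : Function.LeftInverse χ ψ) (ha : 1 < a) (hb : 1 < b) :
    Function.LeftInverse (glueDisks P b a χ) (glueDisks P a b ψ) := by
  intro z
  rcases P.mem_diskEmbed_or_mem_annulus_or_radius_le a z with
    ⟨p, hp, w, hw, rfl⟩ | ⟨p, hp, hzp⟩ | hzP
  · rw [glueDisks_diskEmbed hψ ha hp hw, glueDisks_diskEmbed hχ hb hp (hψ.norm_le w hw), hχψ w]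
  · have hmem := radialStretch.norm_mem_Icc (P.pos p hp) ha hb hzp
    rw [glueDisks_of_mem_annulus hψ ha.le hp hzp, glueDisks_of_mem_annulus hχ hb.le hp
      (by rwa [add_sub_cancel_left]), add_sub_cancel_left,
      radialStretch.leftInverse (P.pos p hp) (P.le_one hp) ha hb, add_sub_cancel]
  · rw [glueDisks_eq_self hψ ha.le hzP, glueDisks_eq_self hχ hb.le hzP]

theorem norm_glueDisks_sub_le (hψ : IsDiskMap ψ) (hχ : IsDiskMap χ) (ha : 1 < a) (hb : 1 ≤ b)
    {C : ℝ} (hC : ∀ z, ‖ψ z - χ z‖ ≤ C) (z : ℂ) :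
    ‖glueDisks P a b ψ z - glueDisks P a b χ z‖ ≤ C / 2 := by
  have hC0 : 0 ≤ C / 2 := div_nonneg ((norm_nonneg _).trans (hC 0)) zero_le_two
  rcases P.mem_diskEmbed_or_mem_annulus_or_radius_le a z with
    ⟨p, hp, w, hw, rfl⟩ | ⟨p, hp, hzp⟩ | hzP
  · rw [glueDisks_diskEmbed hψ ha hp hw, glueDisks_diskEmbed hχ ha hp hw,
      norm_diskEmbed_sub_diskEmbed (P.pos p hp).le]
    calc p.2 ^ b * ‖ψ w - χ w‖ ≤ 1 / 2 * C :=
          mul_le_mul ((P.rpow_le hb hp).trans (P.le_half p hp)) (hC w) (norm_nonneg _)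
            one_half_pos.le
      _ = C / 2 := by ring
  · rwa [glueDisks_of_mem_annulus hψ ha.le hp hzp, glueDisks_of_mem_annulus hχ ha.le hp hzp,
      sub_self, norm_zero]
  · rwa [glueDisks_eq_self hψ ha.le hzP, glueDisks_eq_self hχ ha.le hzP, sub_self, norm_zero]

end glueDisks

/-- The approximating maps: `stageMap P a b N k` carries `cantorStage P a N k` onto
`cantorStage P b N k`. -/
noncomputable def stageMap (P : ℕ → DiskPacking) (a b : ℝ) : ℕ → ℕ → ℂ → ℂ
  | 0, _ => id
  | N + 1, k => glueDisks (P k) a b (stageMap P a b N (k + 1))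

section stageMap

variable (P : ℕ → DiskPacking) {a b : ℝ}

theorem isDiskMap_stageMap (ha : 1 < a) (hb : 1 < b) (N k : ℕ) :
    IsDiskMap (stageMap P a b N k) := by
  induction N generalizing k with
  | zero => exact isDiskMap_id
  | succ N ih => exact isDiskMap_glueDisks (ih (k + 1)) ha hb

theorem exists_lipschitzWith_stageMap (ha : 1 ≤ a) (N k : ℕ) :
    ∃ C, LipschitzWith C (stageMap P a b N k) := by
  induction N generalizing k with
  | zero => exact ⟨1, LipschitzWith.id⟩
  | succ N ih => exact exists_lipschitzWith_glueDisks ha (ih (k + 1))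

theorem leftInverse_stageMap (ha : 1 < a) (hb : 1 < b) (N k : ℕ) :
    Function.LeftInverse (stageMap P b a N k) (stageMap P a b N k) := by
  induction N generalizing k with
  | zero => exact fun _ => rfl
  | succ N ih =>
    exact leftInverse_glueDisks (isDiskMap_stageMap P ha hb N (k + 1))
      (isDiskMap_stageMap P hb ha N (k + 1)) (ih (k + 1)) ha hb

theorem image_stageMap_cantorStage (ha : 1 < a) (hb : 1 < b) (N k : ℕ) :
    stageMap P a b N k '' cantorStage P a N k = cantorStage P b N k := by
  induction N generalizing k with
  | zero => exact image_id _
  | succ N ih =>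
    rw [cantorStage, cantorStage, image_iUnion₂]
    refine iUnion₂_congr fun p hp => ?_
    rw [← ih (k + 1), image_image, image_image]
    refine image_congr fun w hw => glueDisks_diskEmbed (isDiskMap_stageMap P ha hb N (k + 1)) ha hp
      (by simpa using cantorStage_subset_closedBall P ha.le N (k + 1) hw)

theorem stageMap_succ_eq_of_notMem (ha : 1 < a) (hb : 1 < b) (N k : ℕ) {z : ℂ}
    (hz : z ∉ cantorStage P a N k) : stageMap P a b (N + 1) k z = stageMap P a b N k z := by
  induction N generalizing k z with
  | zero =>
    have hz1 : 1 < ‖z‖ := by simpa [cantorStage] using hz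
    exact glueDisks_eq_self_of_one_le_norm isDiskMap_id ha.le hz1.le
  | succ N ih =>
    have hψ := isDiskMap_stageMap P ha hb N (k + 1)
    have hψ' := isDiskMap_stageMap P ha hb (N + 1) (k + 1)
    change glueDisks (P k) a b (stageMap P a b (N + 1) (k + 1)) z =
      glueDisks (P k) a b (stageMap P a b N (k + 1)) z
    rcases (P k).mem_diskEmbed_or_mem_annulus_or_radius_le a z with
      ⟨p, hp, w, hw, rfl⟩ | ⟨p, hp, hzp⟩ | hzP
    · rw [glueDisks_diskEmbed hψ' ha hp hw, glueDisks_diskEmbed hψ ha hp hw, ih]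
      exact fun hwN => hz (mem_iUnion₂.2 ⟨p, hp, mem_image_of_mem _ hwN⟩)
    · rw [glueDisks_of_mem_annulus hψ' ha.le hp hzp, glueDisks_of_mem_annulus hψ ha.le hp hzp]
    · rw [glueDisks_eq_self hψ' ha.le hzP, glueDisks_eq_self hψ ha.le hzP]

theorem stageMap_eq_of_notMem (ha : 1 < a) (hb : 1 < b) {N M : ℕ} (hNM : N ≤ M) (k : ℕ) {z : ℂ}
    (hz : z ∉ cantorStage P a N k) : stageMap P a b M k z = stageMap P a b N k z := by
  induction M, hNM using Nat.le_induction with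
  | base => rfl
  | succ M hM ih =>
    rw [stageMap_succ_eq_of_notMem P ha hb M k fun h => hz (antitone_cantorStage P ha.le k hM h),
      ih]

theorem dist_stageMap_succ_le (ha : 1 < a) (hb : 1 < b) (N k : ℕ) (z : ℂ) :
    dist (stageMap P a b N k z) (stageMap P a b (N + 1) k z) ≤ 4 / 2 / 2 ^ N := by
  rw [dist_comm, dist_eq_norm]
  induction N generalizing k z with
  | zero =>
    have h := isDiskMap_stageMap P ha hb 1 k
    rcases le_total ‖z‖ 1 with hz | hz
    · calc ‖stageMap P a b 1 k z - z‖ ≤ 1 + 1 := norm_sub_le_of_le (h.norm_le z hz) hz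
        _ = 4 / 2 / 2 ^ 0 := by norm_num
    · rw [h.eq_self z hz]
      norm_num [stageMap]
  | succ N ih =>
    calc _ ≤ 4 / 2 / 2 ^ N / 2 :=
          norm_glueDisks_sub_le (isDiskMap_stageMap P ha hb (N + 1) (k + 1))
            (isDiskMap_stageMap P ha hb N (k + 1)) ha hb.le (ih (k + 1)) z
      _ = 4 / 2 / 2 ^ (N + 1) := by rw [pow_succ]; ring

end stageMap

/-- The limit of the approximating maps, which carries the Cantor set `C_a` onto `C_b`. -/
noncomputable def cantorMap (P : ℕ → DiskPacking) (a b : ℝ) (z : ℂ) : ℂ :=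
  limUnder atTop fun N => stageMap P a b N 0 z

section cantorMap

variable (P : ℕ → DiskPacking) {a b : ℝ}

theorem tendsto_stageMap (ha : 1 < a) (hb : 1 < b) (z : ℂ) :
    Tendsto (fun N => stageMap P a b N 0 z) atTop (𝓝 (cantorMap P a b z)) :=
  (cauchySeq_of_le_geometric_two fun N => dist_stageMap_succ_le P ha hb N 0 z).tendsto_limUnder

theorem tendstoUniformly_stageMap (ha : 1 < a) (hb : 1 < b) :
    TendstoUniformly (fun N => stageMap P a b N 0) (cantorMap P a b) atTop := by
  rw [tendstoUniformly_iff]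
  intro ε hε
  have hlim : Tendsto (fun N : ℕ => (4 : ℝ) / 2 ^ N) atTop (𝓝 0) := by
    simpa [div_eq_mul_inv] using (tendsto_pow_atTop_nhds_zero_of_lt_one (r := (1 / 2 : ℝ))
      (by norm_num) (by norm_num)).const_mul 4
  filter_upwards [hlim.eventually_lt_const hε] with N hN z
  rw [dist_comm]
  exact (dist_le_of_le_geometric_two_of_tendsto
    (fun N => dist_stageMap_succ_le P ha hb N 0 z) (tendsto_stageMap P ha hb z) N).trans_lt hN

theorem continuous_cantorMap (ha : 1 < a) (hb : 1 < b) : Continuous (cantorMap P a b) :=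
  (tendstoUniformly_stageMap P ha hb).continuous
    (Frequently.of_forall fun N => (isDiskMap_stageMap P ha hb N 0).continuous)

theorem leftInverse_cantorMap (ha : 1 < a) (hb : 1 < b) :
    Function.LeftInverse (cantorMap P b a) (cantorMap P a b) := by
  intro z
  have h := (tendstoUniformly_stageMap P hb ha).tendsto_comp
    (continuous_cantorMap P hb ha).continuousAt (tendsto_stageMap P ha hb z)
  simp only [leftInverse_stageMap P ha hb _ 0 z] at h
  exact tendsto_nhds_unique h tendsto_const_nhds

theorem isHomeomorph_cantorMap (ha : 1 < a) (hb : 1 < b) : IsHomeomorph (cantorMap P a b) :=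
  (Homeomorph.mk ⟨cantorMap P a b, cantorMap P b a, leftInverse_cantorMap P ha hb,
    leftInverse_cantorMap P hb ha⟩ (continuous_cantorMap P ha hb)
    (continuous_cantorMap P hb ha)).isHomeomorph

theorem cantorMap_eq_stageMap (ha : 1 < a) (hb : 1 < b) {N : ℕ} {z : ℂ}
    (hz : z ∉ cantorStage P a N 0) : cantorMap P a b z = stageMap P a b N 0 z := by
  refine tendsto_nhds_unique (tendsto_stageMap P ha hb z) (tendsto_const_nhds.congr' ?_)
  filter_upwards [eventually_ge_atTop N] with M hM
  exact (stageMap_eq_of_notMem P ha hb hM 0 hz).symm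

theorem image_cantorMap_cantorStage (ha : 1 < a) (hb : 1 < b) (N : ℕ) :
    cantorMap P a b '' cantorStage P a N 0 = cantorStage P b N 0 := by
  have hstage : Function.Bijective (stageMap P a b N 0) :=
    ⟨(leftInverse_stageMap P ha hb N 0).injective, (leftInverse_stageMap P hb ha N 0).surjective⟩
  -- Both maps are bijective and they agree on the complement of the stage.
  rw [← compl_inj_iff, ← image_compl_eq (isHomeomorph_cantorMap P ha hb).bijective,
    ← image_stageMap_cantorStage P ha hb, ← image_compl_eq hstage]
  exact image_congr fun z hz => cantorMap_eq_stageMap P ha hb hz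

theorem image_cantorMap_packingCantor (ha : 1 < a) (hb : 1 < b) :
    cantorMap P a b '' packingCantor P a = packingCantor P b := by
  rw [packingCantor, image_iInter (isHomeomorph_cantorMap P ha hb).bijective]
  exact iInter_congr (image_cantorMap_cantorStage P ha hb)

end cantorMap

/-! ### Distortion -/

theorem det_clm_complex (L : ℂ →L[ℝ] ℂ) :
    L.det = (L 1).re * (L Complex.I).im - (L 1).im * (L Complex.I).re := by
  rw [ContinuousLinearMap.det, ← LinearMap.det_toMatrix Complex.basisOneI, Matrix.det_fin_two]
  simp only [LinearMap.toMatrix_apply, Complex.coe_basisOneI, Complex.coe_basisOneI_repr,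
    Matrix.cons_val_zero, Matrix.cons_val_one, ContinuousLinearMap.coe_coe]
  ring

theorem det_clm_complex_mul_norm_sq_le (L : ℂ →L[ℝ] ℂ) (v : ℂ) :
    L.det * ‖v‖ ^ 2 ≤ ‖L v‖ * ‖L (Complex.I * v)‖ := by
  have hLxy : ∀ x y : ℝ, L (x • 1 + y • Complex.I) = x * L 1 + y * L Complex.I := fun x y => by
    rw [map_add, map_smul, map_smul, Complex.real_smul, Complex.real_smul]
  have hv : v = v.re • 1 + v.im • Complex.I := by apply Complex.ext <;> simp
  have hIv : Complex.I * v = (-v.im) • 1 + v.re • Complex.I := by apply Complex.ext <;> simp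
  have hLv : L v = v.re * L 1 + v.im * L Complex.I := (congrArg L hv).trans (hLxy _ _)
  calc L.det * ‖v‖ ^ 2 = (starRingEnd ℂ (L v) * L (Complex.I * v)).im := by
        rw [hIv, hLxy, hLv, det_clm_complex, Complex.sq_norm, Complex.normSq_apply]
        simp only [map_add, map_mul, Complex.conj_ofReal, Complex.mul_im, Complex.mul_re,
          Complex.add_re, Complex.add_im, Complex.conj_re, Complex.conj_im, Complex.ofReal_re,
          Complex.ofReal_im]
        ring
    _ ≤ ‖L v‖ * ‖L (Complex.I * v)‖ := by
        refine (Complex.im_le_norm _).trans_eq ?_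
        rw [norm_mul, RCLike.norm_conj]

/-- The distortion inequality `‖L‖² ≤ K det L` for a real-linear map of the plane. It says that `L`
does not reverse the orientation and that `L`, unless it is zero, maps circles to ellipses whose
axes have ratio at most `K`. -/
def HasDistortionLE (K : ℝ) (L : ℂ →L[ℝ] ℂ) : Prop := ∀ h, ‖L h‖ ^ 2 ≤ K * L.det * ‖h‖ ^ 2

namespace HasDistortionLE

variable {K : ℝ} {L : ℂ →L[ℝ] ℂ}

theorem id (hK : 1 ≤ K) : HasDistortionLE K (ContinuousLinearMap.id ℝ ℂ) := by
  intro h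
  rw [ContinuousLinearMap.det, ContinuousLinearMap.coe_id, LinearMap.det_id, mul_one]
  exact le_mul_of_one_le_left (sq_nonneg _) hK

theorem smul (hL : HasDistortionLE K L) (c : ℝ) : HasDistortionLE K (c • L) := by
  intro h
  have hdet : (c • L).det = c ^ 2 * L.det := by
    rw [ContinuousLinearMap.det, ContinuousLinearMap.toLinearMap_smul, LinearMap.det_smul,
      Complex.finrank_real_complex, ContinuousLinearMap.det]
  calc ‖(c • L) h‖ ^ 2 = c ^ 2 * ‖L h‖ ^ 2 := by
        rw [smul_apply, norm_smul, mul_pow, Real.norm_eq_abs, sq_abs]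
    _ ≤ c ^ 2 * (K * L.det * ‖h‖ ^ 2) := mul_le_mul_of_nonneg_left (hL h) (sq_nonneg c)
    _ = K * (c • L).det * ‖h‖ ^ 2 := by rw [hdet]; ring

theorem norm_sq_le_mul_det (hL : HasDistortionLE K L) {v : ℂ} (hv : ‖v‖ = 1) :
    ‖L v‖ ^ 2 ≤ K * L.det := by
  simpa only [hv, one_pow, mul_one] using hL v

theorem det_nonneg (hL : HasDistortionLE K L) (hK : 0 < K) : 0 ≤ L.det :=
  nonneg_of_mul_nonneg_right ((sq_nonneg _).trans (hL.norm_sq_le_mul_det norm_one)) hK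

theorem norm_le_mul_norm (hL : HasDistortionLE K L) (hK : 0 < K) {u v : ℂ} (hu : ‖u‖ = 1)
    (hv : ‖v‖ = 1) : ‖L u‖ ≤ K * ‖L v‖ := by
  have hle : ∀ w : ℂ, ‖w‖ = 1 → ‖L w‖ ^ 2 ≤ K * (‖L v‖ * ‖L (Complex.I * v)‖) := by
    intro w hw
    refine (hL.norm_sq_le_mul_det hw).trans (mul_le_mul_of_nonneg_left ?_ hK.le)
    simpa only [hv, one_pow, mul_one] using det_clm_complex_mul_norm_sq_le L v
  have hIv : ‖L (Complex.I * v)‖ ≤ K * ‖L v‖ := by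
    rcases (norm_nonneg (L (Complex.I * v))).eq_or_lt with h0 | h0
    · rw [← h0]
      positivity
    · refine le_of_mul_le_mul_right ?_ h0
      simpa only [sq, mul_assoc] using hle (Complex.I * v) (by simp [hv])
  refine le_of_sq_le_sq ?_ (by positivity)
  calc ‖L u‖ ^ 2 ≤ K * (‖L v‖ * ‖L (Complex.I * v)‖) := hle u hu
    _ ≤ K * (‖L v‖ * (K * ‖L v‖)) := by gcongr
    _ = (K * ‖L v‖) ^ 2 := by ring

end HasDistortionLE

/-- `f` is real differentiable at `z` and its derivative satisfies the distortion inequality with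
constant `K`. -/
def HasDistortionAt (K : ℝ) (f : ℂ → ℂ) (z : ℂ) : Prop :=
  ∃ L : ℂ →L[ℝ] ℂ, HasFDerivAt f L z ∧ HasDistortionLE K L

namespace HasDistortionAt

variable {K : ℝ} {f g : ℂ → ℂ} {z : ℂ}

theorem congr_of_eventuallyEq (hf : HasDistortionAt K f z) (h : g =ᶠ[𝓝 z] f) :
    HasDistortionAt K g z := by
  obtain ⟨L, hL, hK⟩ := hf
  exact ⟨L, hL.congr_of_eventuallyEq h, hK⟩

theorem id (hK : 1 ≤ K) : HasDistortionAt K (fun w => w) z :=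
  ⟨_, hasFDerivAt_id z, .id hK⟩

theorem comp_affine {c : ℂ} {r : ℝ} (s : ℝ) (hf : HasDistortionAt K f (r • (z - c))) :
    HasDistortionAt K (fun w => c + s • f (r • (w - c))) z := by
  obtain ⟨L, hL, hK⟩ := hf
  have haff : HasFDerivAt (fun w : ℂ => r • (w - c)) (r • ContinuousLinearMap.id ℝ ℂ) z :=
    ((hasFDerivAt_id z).sub_const c).const_smul r
  refine ⟨s • r • L, ?_, (hK.smul r).smul s⟩
  have hcomp := ((hL.comp z haff).const_smul s).const_add c
  rwa [ContinuousLinearMap.comp_smul, ContinuousLinearMap.comp_id] at hcomp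

end HasDistortionAt

theorem hasFDerivAt_norm_div_rpow_smul {E : Type*} [NormedAddCommGroup E] [InnerProductSpace ℝ E]
    {R : ℝ} (hR : 0 < R) (t : ℝ) {z : E} (hz : z ≠ 0) :
    HasFDerivAt (fun w : E => ((‖w‖ / R) ^ t : ℝ) • w)
      (((‖z‖ / R) ^ t : ℝ) • (ContinuousLinearMap.id ℝ E +
        (t / ‖z‖ ^ 2) • (innerSL ℝ z).smulRight z)) z := by
  have hzR : 0 < ‖z‖ ^ 2 * (R ^ 2)⁻¹ := by positivity
  have hpow : ∀ w : E, (‖w‖ / R) ^ t = (‖w‖ ^ 2 * (R ^ 2)⁻¹) ^ (t / 2) := by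
    intro w
    rw [← div_eq_mul_inv, ← div_pow, ← Real.rpow_two, ← Real.rpow_mul (by positivity),
      mul_div_cancel₀ _ two_ne_zero]
  have hderiv := (((hasStrictFDerivAt_norm_sq z).hasFDerivAt.mul_const (R ^ 2)⁻¹).rpow_const
    (p := t / 2) (Or.inl hzR.ne')).smul (hasFDerivAt_id z)
  simp only [hpow]
  refine hderiv.congr_fderiv ?_
  ext h
  rw [Real.rpow_sub_one hzR.ne']
  simp only [id_eq, add_apply, smul_apply, ContinuousLinearMap.id_apply,
    ContinuousLinearMap.smulRight_apply, coe_innerSL_apply, nsmul_eq_mul, Nat.cast_ofNat,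
    smul_eq_mul, smul_add, add_right_inj]
  match_scalars
  field_simp

theorem hasDistortionLE_id_add_smulRight {t : ℝ} (ht : -1 < t) (ht0 : t ≤ 0) {z : ℂ} (hz : z ≠ 0) :
    HasDistortionLE (1 + t)⁻¹ (ContinuousLinearMap.id ℝ ℂ +
      (t / ‖z‖ ^ 2) • (innerSL ℝ z).smulRight z) := by
  have hz2 : 0 < ‖z‖ ^ 2 := by positivity
  have hsq : ‖z‖ ^ 2 = z.re ^ 2 + z.im ^ 2 := by rw [Complex.sq_norm, Complex.normSq_apply]; ring
  set κ := t / ‖z‖ ^ 2 with hκ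
  have hκz : κ * ‖z‖ ^ 2 = t := div_mul_cancel₀ _ hz2.ne'
  set L := ContinuousLinearMap.id ℝ ℂ + κ • (innerSL ℝ z).smulRight z with hL
  have hLh : ∀ h : ℂ, L h = h + (κ * inner ℝ z h) • z := fun h => by
    simp [hL, mul_assoc]
  have hdet : L.det = 1 + t := by
    rw [det_clm_complex, hLh, hLh]
    simp only [Complex.inner, one_mul, mul_neg, Complex.conj_re, Complex.conj_im, Complex.add_re,
      Complex.add_im, Complex.smul_re, Complex.smul_im, smul_eq_mul, Complex.mul_re,
      Complex.one_re, Complex.one_im, Complex.I_re, Complex.I_im]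
    linear_combination hκz - κ * hsq
  intro h
  have hnorm : ‖L h‖ ^ 2 = ‖h‖ ^ 2 + t * (2 + t) * (inner ℝ z h ^ 2 / ‖z‖ ^ 2) := by
    rw [hLh, norm_add_sq_real, inner_smul_right, norm_smul, Real.norm_eq_abs, mul_pow, sq_abs,
      real_inner_comm z h, hκ]
    field_simp
    ring
  rw [hdet, inv_mul_cancel₀ (by linarith), one_mul, hnorm]
  have : t * (2 + t) ≤ 0 := mul_nonpos_of_nonpos_of_nonneg ht0 (by linarith)
  nlinarith [div_nonneg (sq_nonneg (inner ℝ z h)) hz2.le]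

theorem ae_norm_sub_ne {E : Type*} [NormedAddCommGroup E] [NormedSpace ℝ E] [FiniteDimensional ℝ E]
    [Nontrivial E] [MeasurableSpace E] [BorelSpace E] (μ : Measure E) [μ.IsAddHaarMeasure] (c : E)
    (r : ℝ) : ∀ᵐ z ∂μ, ‖z - c‖ ≠ r := by
  filter_upwards [measure_eq_zero_iff_ae_notMem.1 (Measure.addHaar_sphere μ c r)] with z hz
  rwa [mem_sphere_iff_norm] at hz

theorem ae_smul_sub {E : Type*} [NormedAddCommGroup E] [NormedSpace ℝ E] [FiniteDimensional ℝ E]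
    [MeasurableSpace E] [BorelSpace E] {μ : Measure E} [μ.IsAddHaarMeasure] {Q : E → Prop}
    (hQ : ∀ᵐ z ∂μ, Q z) (c : E) {r : ℝ} (hr : r ≠ 0) : ∀ᵐ z ∂μ, Q (r • (z - c)) :=
  ((Measure.quasiMeasurePreserving_smul μ hr).comp
    (measurePreserving_sub_right μ c).quasiMeasurePreserving).ae hQ

theorem continuous_norm_sub_const {E : Type*} [SeminormedAddCommGroup E] (c : E) :
    Continuous fun z => ‖z - c‖ := by
  fun_prop

section glueDisks

variable {P : DiskPacking} {a b K : ℝ} {ψ : ℂ → ℂ} {p : ℂ × ℝ} {z : ℂ}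

theorem hasDistortionAt_glueDisks_of_norm_sub_lt (hψ : IsDiskMap ψ) (ha : 1 < a)
    (hp : p ∈ P.disks) (hz : ‖z - p.1‖ < p.2 ^ a)
    (hK : HasDistortionAt K ψ ((p.2 ^ a)⁻¹ • (z - p.1))) :
    HasDistortionAt K (glueDisks P a b ψ) z := by
  refine (hK.comp_affine (p.2 ^ b)).congr_of_eventuallyEq ?_
  have hpa := P.rpow_pos a hp
  filter_upwards [(continuous_norm_sub_const p.1).continuousAt.eventually_lt_const hz] with w hw
  have hw' : ‖(p.2 ^ a)⁻¹ • (w - p.1)‖ ≤ 1 := by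
    rw [norm_smul, norm_inv, Real.norm_of_nonneg hpa.le]
    exact inv_mul_le_one_of_le₀ hw.le hpa.le
  have hw_eq : diskEmbed a p ((p.2 ^ a)⁻¹ • (w - p.1)) = w := by
    rw [diskEmbed, smul_inv_smul₀ hpa.ne', add_sub_cancel]
  rw [← hw_eq, glueDisks_diskEmbed hψ ha hp hw', hw_eq, diskEmbed]

theorem hasDistortionAt_glueDisks_of_mem_annulus (hψ : IsDiskMap ψ) (hb : 1 < b) (hba : b ≤ a)
    (hp : p ∈ P.disks) (hz : ‖z - p.1‖ ∈ Ioo (p.2 ^ a) p.2) :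
    HasDistortionAt ((a - 1) / (b - 1)) (glueDisks P a b ψ) z := by
  have ha0 : 0 < a - 1 := by linarith
  set t := (b - a) / (a - 1) with ht
  have ht1 : 1 + t = (b - 1) / (a - 1) := by rw [ht]; field_simp; ring
  have ht_gt : -1 < t := by
    have : 0 < 1 + t := ht1 ▸ div_pos (by linarith) ha0
    linarith
  have ht0 : t ≤ 0 := div_nonpos_of_nonpos_of_nonneg (by linarith) ha0.le
  have hz0 : z - p.1 ≠ 0 := norm_pos_iff.1 ((P.rpow_pos a hp).trans hz.1)
  have hstretch : HasDistortionAt (1 + t)⁻¹ (fun w : ℂ => ((‖w‖ / p.2) ^ t : ℝ) • w) (z - p.1) :=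
    ⟨_, hasFDerivAt_norm_div_rpow_smul (P.pos p hp) t hz0,
      (hasDistortionLE_id_add_smulRight ht_gt ht0 hz0).smul _⟩
  rw [ht1, inv_div, ← one_smul ℝ (z - p.1)] at hstretch
  refine (hstretch.comp_affine 1).congr_of_eventuallyEq ?_
  filter_upwards [(continuous_norm_sub_const p.1).continuousAt.eventually_mem
    (isOpen_Ioo.mem_nhds hz)] with w hw
  have hw' := Ioo_subset_Icc_self hw
  rw [glueDisks_of_mem_annulus hψ (by linarith) hp hw', radialStretch.eq_smul_of_mem_Icc hw',
    one_smul, one_smul]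

theorem hasDistortionAt_glueDisks_of_forall_lt (hψ : IsDiskMap ψ) (ha : 1 ≤ a) (hK : 1 ≤ K)
    (hz : ∀ p ∈ P.disks, p.2 < ‖z - p.1‖) : HasDistortionAt K (glueDisks P a b ψ) z := by
  refine (HasDistortionAt.id hK).congr_of_eventuallyEq ?_
  filter_upwards [(Filter.eventually_all_finset P.disks).2 fun p hp =>
    (continuous_norm_sub_const p.1).continuousAt.eventually_const_lt (hz p hp)] with w hw
  exact glueDisks_eq_self hψ ha fun p hp => (hw p hp).le

theorem ae_hasDistortionAt_glueDisks (hψ : IsDiskMap ψ) (hb : 1 < b) (hba : b ≤ a)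
    (hK : ∀ᵐ z, HasDistortionAt ((a - 1) / (b - 1)) ψ z) :
    ∀ᵐ z, HasDistortionAt ((a - 1) / (b - 1)) (glueDisks P a b ψ) z := by
  have ha : 1 < a := hb.trans_le hba
  have hgeneric : ∀ᵐ z, ∀ p ∈ P.disks, ‖z - p.1‖ ≠ p.2 ∧ ‖z - p.1‖ ≠ p.2 ^ a ∧
      HasDistortionAt ((a - 1) / (b - 1)) ψ ((p.2 ^ a)⁻¹ • (z - p.1)) := by
    refine (Filter.eventually_all_finset P.disks).2 fun p hp => ?_
    filter_upwards [ae_norm_sub_ne volume p.1 p.2, ae_norm_sub_ne volume p.1 (p.2 ^ a),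
      ae_smul_sub hK p.1 (inv_pos.2 (P.rpow_pos a hp)).ne'] with z h₁ h₂ h₃
    exact ⟨h₁, h₂, h₃⟩
  filter_upwards [hgeneric] with z hz
  rcases P.mem_diskEmbed_or_mem_annulus_or_radius_le a z with
    ⟨p, hp, w, hw, rfl⟩ | ⟨p, hp, hzp⟩ | hout
  · obtain ⟨-, hne, hw'⟩ := hz p hp
    refine hasDistortionAt_glueDisks_of_norm_sub_lt hψ ha hp (lt_of_le_of_ne ?_ hne) hw'
    rw [norm_diskEmbed_sub (P.pos p hp).le]
    exact mul_le_of_le_one_right (P.rpow_pos a hp).le hw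
  · obtain ⟨hne, hne', -⟩ := hz p hp
    exact hasDistortionAt_glueDisks_of_mem_annulus hψ hb hba hp
      ⟨lt_of_le_of_ne hzp.1 hne'.symm, lt_of_le_of_ne hzp.2 hne⟩
  · refine hasDistortionAt_glueDisks_of_forall_lt hψ ha.le ?_ fun p hp =>
      lt_of_le_of_ne (hout p hp) (hz p hp).1.symm
    rw [one_le_div (by linarith)]
    linarith

end glueDisks

theorem ae_hasDistortionAt_stageMap (P : ℕ → DiskPacking) {a b : ℝ} (hb : 1 < b) (hba : b ≤ a)
    (N k : ℕ) : ∀ᵐ z, HasDistortionAt ((a - 1) / (b - 1)) (stageMap P a b N k) z := by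
  induction N generalizing k with
  | zero =>
    refine Eventually.of_forall fun z => .id ?_
    rw [one_le_div (by linarith)]
    linarith
  | succ N ih =>
    exact ae_hasDistortionAt_glueDisks
      (isDiskMap_stageMap P (hb.trans_le hba) hb N (k + 1)) hb hba (ih (k + 1))

/-! ### Weak derivatives -/

theorem IsL2Loc.locallyIntegrable {f : ℂ → ℂ} (hf : IsL2Loc f) : LocallyIntegrable f := by
  rw [locallyIntegrable_iff]
  intro C hC
  have : IsFiniteMeasure (volume.restrict C) := ⟨by simpa using hC.measure_lt_top⟩
  exact (hf C hC).integrable (by norm_num)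

theorem isL2Loc_of_continuous {f : ℂ → ℂ} (hf : Continuous f) : IsL2Loc f := by
  intro C hC
  have : IsFiniteMeasure (volume.restrict C) := ⟨by simpa using hC.measure_lt_top⟩
  obtain ⟨M, hM⟩ := hC.exists_bound_of_continuousOn hf.continuousOn
  exact MemLp.of_bound hf.aestronglyMeasurable M (ae_restrict_of_forall_mem hC.measurableSet hM)

theorem isWeakPartial_lineDeriv_of_lipschitzWith {f : ℂ → ℂ} {C : NNReal} (hf : LipschitzWith C f)
    (v : ℂ) : IsWeakPartial v f fun z => lineDeriv ℝ f z v := by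
  intro ψ hψ hψc
  obtain ⟨D, hD⟩ := ContDiff.lipschitzWith_of_hasCompactSupport hψc hψ (by simp)
  have hderiv : Continuous fun z => fderiv ℝ ψ z v :=
    (hψ.continuous_fderiv (by simp)).clm_apply continuous_const
  have hint₁ : Integrable fun z => fderiv ℝ ψ z v • f z :=
    (hderiv.smul hf.continuous).integrable_of_hasCompactSupport
      (hψc.fderiv_apply (𝕜 := ℝ) v).smul_right
  have hint₂ : Integrable fun z => ψ z • lineDeriv ℝ f z v :=
    (hψ.continuous.integrable_of_hasCompactSupport hψc).smul_bdd (C * ‖v‖)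
      (aestronglyMeasurable_lineDeriv hf.continuous volume)
      (Eventually.of_forall fun z => norm_lineDeriv_le_of_lipschitz ℝ hf)
  have hcoord : ∀ (T : ℂ →L[ℝ] ℝ),
      T (∫ z, fderiv ℝ ψ z v • f z) = T (- ∫ z, ψ z • lineDeriv ℝ f z v) := by
    intro T
    have hparts := (T.lipschitz.comp hf).integral_lineDeriv_mul_eq (μ := volume) hD hψc v
    have hleft : ∫ z, lineDeriv ℝ (T ∘ f) z v * ψ z = ∫ z, T (ψ z • lineDeriv ℝ f z v) := by
      refine integral_congr_ae ?_
      filter_upwards [hf.ae_differentiableAt (μ := volume)] with z hz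
      rw [((T.hasFDerivAt.comp z hz.hasFDerivAt).hasLineDerivAt v).lineDeriv,
        (hz.hasFDerivAt.hasLineDerivAt v).lineDeriv, map_smul, smul_eq_mul, mul_comm,
        ContinuousLinearMap.comp_apply]
    have hright : ∫ z, lineDeriv ℝ ψ z (-v) * (T ∘ f) z = - ∫ z, T (fderiv ℝ ψ z v • f z) := by
      rw [← integral_neg]
      refine integral_congr_ae (Eventually.of_forall fun z => ?_)
      dsimp only
      rw [(((hψ.differentiable (by simp)) z).hasFDerivAt.hasLineDerivAt (-v)).lineDeriv, map_smul,
        map_neg, smul_eq_mul, neg_mul, Function.comp_apply]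
    rw [map_neg, ← T.integral_comp_comm hint₁, ← T.integral_comp_comm hint₂, ← hleft, hparts,
      hright, neg_neg]
  exact Complex.ext (hcoord Complex.reCLM) (hcoord Complex.imCLM)

theorem tendsto_integral_smul_of_tendstoUniformly {X E : Type*} [TopologicalSpace X]
    [MeasurableSpace X] [OpensMeasurableSpace X] {μ : Measure X} [IsFiniteMeasureOnCompacts μ]
    [NormedAddCommGroup E] [NormedSpace ℝ E] [SecondCountableTopologyEither X E] {χ : X → ℝ}
    (hχ : Continuous χ) (hχc : HasCompactSupport χ) {f : ℕ → X → E} {φ : X → E}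
    (hf : ∀ N, Continuous (f N)) (hunif : TendstoUniformly f φ atTop) :
    Tendsto (fun N => ∫ x, χ x • f N x ∂μ) atTop (𝓝 (∫ x, χ x • φ x ∂μ)) := by
  have hφ : Continuous φ := hunif.continuous (Frequently.of_forall hf)
  refine tendsto_integral_filter_of_dominated_convergence (fun x => ‖χ x‖ * (‖φ x‖ + 1))
    (Eventually.of_forall fun N => (hχ.smul (hf N)).aestronglyMeasurable) ?_
    ((hχ.norm.mul (hφ.norm.add continuous_const)).integrable_of_hasCompactSupport
      hχc.norm.mul_right)
    (Eventually.of_forall fun x => (hunif.tendsto_at x).const_smul _)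
  filter_upwards [Metric.tendstoUniformly_iff.1 hunif 1 one_pos] with N hN
  refine Eventually.of_forall fun x => ?_
  have hle : ‖f N x‖ ≤ ‖φ x‖ + 1 := by
    have hdist := hN x
    rw [dist_eq_norm'] at hdist
    linarith [norm_sub_norm_le (f N x) (φ x)]
  rw [norm_smul]
  gcongr

theorem eLpNorm_one_le_eLpNorm_two_mul_measure_rpow {X E : Type*} [MeasurableSpace X]
    [NormedAddCommGroup E] {μ : Measure X} {u : X → E} (hu : AEStronglyMeasurable u μ) {B : Set X}
    (hB : Function.support u ⊆ B) :
    eLpNorm u 1 μ ≤ eLpNorm u 2 (μ.restrict B) * μ B ^ (1 / 2 : ℝ) := by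
  rw [← eLpNorm_restrict_eq_of_support_subset hB]
  refine (eLpNorm_le_eLpNorm_mul_rpow_measure_univ (q := 2) (by norm_num) hu.restrict).trans_eq ?_
  rw [Measure.restrict_apply_univ]
  norm_num

theorem tendsto_eLpNorm_one_of_support_subset {X E : Type*} [MeasurableSpace X]
    [NormedAddCommGroup E] {μ : Measure X} {u : ℕ → X → E} (hu : ∀ N, AEStronglyMeasurable (u N) μ)
    {B : ℕ → Set X} (hB : ∀ N, Function.support (u N) ⊆ B N)
    (hμB : Tendsto (fun N => μ (B N)) atTop (𝓝 0)) {C : ℝ≥0∞} (hC : C ≠ ⊤)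
    (huC : ∀ N, eLpNorm (u N) 2 (μ.restrict (B N)) ≤ C) :
    Tendsto (fun N => eLpNorm (u N) 1 μ) atTop (𝓝 0) := by
  have hroot : Tendsto (fun N => C * μ (B N) ^ (1 / 2 : ℝ)) atTop (𝓝 0) := by
    have h := ((ENNReal.continuous_rpow_const (y := (1 / 2 : ℝ))).tendsto 0).comp hμB
    rw [ENNReal.zero_rpow_of_pos (by norm_num)] at h
    simpa only [mul_zero, Function.comp_apply] using ENNReal.Tendsto.const_mul h (Or.inr hC)
  refine tendsto_of_tendsto_of_tendsto_of_le_of_le tendsto_const_nhds hroot (fun _ => zero_le)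
    fun N => (eLpNorm_one_le_eLpNorm_two_mul_measure_rpow (hu N) (hB N)).trans ?_
  gcongr
  exact huC N

theorem isWeakPartial_of_tendstoUniformly {v : ℂ} {f g : ℕ → ℂ → ℂ} {φ p : ℂ → ℂ}
    (hf : ∀ N, Continuous (f N)) (hunif : TendstoUniformly f φ atTop)
    (hfg : ∀ N, IsWeakPartial v (f N) (g N)) (hg : ∀ N, LocallyIntegrable (g N))
    (hp : LocallyIntegrable p) (hgp : Tendsto (fun N => eLpNorm (g N - p) 1) atTop (𝓝 0)) :
    IsWeakPartial v φ p := by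
  intro ψ hψ hψc
  have hleft : Tendsto (fun N => ∫ z, fderiv ℝ ψ z v • f N z) atTop
      (𝓝 (∫ z, fderiv ℝ ψ z v • φ z)) :=
    tendsto_integral_smul_of_tendstoUniformly
      ((hψ.continuous_fderiv (by simp)).clm_apply continuous_const)
      (hψc.fderiv_apply (𝕜 := ℝ) v) hf hunif
  have hright : Tendsto (fun N => ∫ z, ψ z • g N z) atTop (𝓝 (∫ z, ψ z • p z)) := by
    have hint : ∀ {q : ℂ → ℂ}, LocallyIntegrable q → Integrable fun z => ψ z • q z := fun hq =>
      hq.integrable_smul_left_of_hasCompactSupport hψ.continuous hψc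
    obtain ⟨M, hM⟩ := hψc.exists_bound_of_continuous hψ.continuous
    have hle : ∀ N, eLpNorm ((fun z => ψ z • g N z) - fun z => ψ z • p z) 1 ≤
        ENNReal.ofReal M * eLpNorm (g N - p) 1 := by
      refine fun N => eLpNorm_le_mul_eLpNorm_of_ae_le_mul (Eventually.of_forall fun z => ?_) 1
      rw [Pi.sub_apply, ← smul_sub, norm_smul]
      exact mul_le_mul_of_nonneg_right (hM z) (norm_nonneg _)
    have hlim := ENNReal.Tendsto.const_mul (a := ENNReal.ofReal M) hgp
      (Or.inr ENNReal.ofReal_ne_top)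
    rw [mul_zero] at hlim
    exact tendsto_integral_of_L1' _ (hint hp).aestronglyMeasurable
      (Eventually.of_forall fun N => hint (hg N))
      (tendsto_of_tendsto_of_tendsto_of_le_of_le tendsto_const_nhds hlim (fun _ => zero_le) hle)
  exact tendsto_nhds_unique hleft (hright.neg.congr fun N => (hfg N ψ hψ hψc).symm)

theorem HasDistortionAt.enorm_lineDeriv_sq_le {K : ℝ} (hK : 0 ≤ K) {f : ℂ → ℂ} {z : ℂ}
    (hf : HasDistortionAt K f z) {v : ℂ} (hv : ‖v‖ = 1) :
    ‖lineDeriv ℝ f z v‖ₑ ^ (2 : ℝ) ≤ ENNReal.ofReal K * ENNReal.ofReal |(fderiv ℝ f z).det| := by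
  obtain ⟨L, hL, hLK⟩ := hf
  rw [hL.fderiv, (hL.hasLineDerivAt v).lineDeriv, ← ENNReal.ofReal_mul hK, ← ofReal_norm,
    ENNReal.ofReal_rpow_of_nonneg (norm_nonneg _) (by norm_num), Real.rpow_two]
  refine ENNReal.ofReal_le_ofReal ((hLK.norm_sq_le_mul_det hv).trans ?_)
  gcongr
  exact le_abs_self _

-- Energy is bounded by area: `|∂_v f|² ≤ K J_f`, and the Jacobian integrates to the image area.
theorem eLpNorm_lineDeriv_le {K : ℝ} (hK : 0 ≤ K) {f : ℂ → ℂ} (hinj : Function.Injective f)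
    (hf : ∀ᵐ z, HasDistortionAt K f z) {v : ℂ} (hv : ‖v‖ = 1) {A : Set ℂ} (hA : MeasurableSet A) :
    eLpNorm (fun z => lineDeriv ℝ f z v) 2 (volume.restrict A) ≤
      (ENNReal.ofReal K * volume (f '' A)) ^ (1 / 2 : ℝ) := by
  set S := {z | DifferentiableAt ℝ f z}
  have hres : volume.restrict A = volume.restrict (A ∩ S) := by
    refine Measure.restrict_congr_set (inter_ae_eq_left_of_ae_eq_univ ?_).symm
    filter_upwards [hf] with z ⟨L, hL, _⟩
    exact eq_true hL.differentiableAt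
  rw [eLpNorm_eq_lintegral_rpow_enorm_toReal (by norm_num) (by norm_num), ENNReal.toReal_ofNat]
  gcongr
  calc ∫⁻ z in A, ‖lineDeriv ℝ f z v‖ₑ ^ (2 : ℝ)
      ≤ ∫⁻ z in A, ENNReal.ofReal K * ENNReal.ofReal |(fderiv ℝ f z).det| :=
        lintegral_mono_ae (ae_restrict_of_ae
          (hf.mono fun z hz => hz.enorm_lineDeriv_sq_le hK hv))
    _ = ENNReal.ofReal K * ∫⁻ z in A ∩ S, ENNReal.ofReal |(fderiv ℝ f z).det| := by
        rw [lintegral_const_mul' _ _ ENNReal.ofReal_ne_top, hres]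
    _ = ENNReal.ofReal K * volume (f '' (A ∩ S)) := by
        rw [lintegral_abs_det_fderiv_eq_addHaar_image volume
          (hA.inter (measurableSet_of_differentiableAt ℝ f))
          (fun z hz => hz.2.hasFDerivAt.hasFDerivWithinAt) hinj.injOn]
    _ ≤ ENNReal.ofReal K * volume (f '' A) := by
        gcongr
        exact inter_subset_left

theorem isL2Loc_lineDeriv {K : ℝ} (hK : 0 ≤ K) {f : ℂ → ℂ} (hf : Continuous f)
    (hinj : Function.Injective f) (hfK : ∀ᵐ z, HasDistortionAt K f z) {v : ℂ} (hv : ‖v‖ = 1) :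
    IsL2Loc fun z => lineDeriv ℝ f z v := by
  intro C hC
  refine ⟨(measurable_lineDeriv hf).aestronglyMeasurable,
    (eLpNorm_lineDeriv_le hK hinj hfK hv hC.measurableSet).trans_lt ?_⟩
  exact ENNReal.rpow_lt_top_of_nonneg (by norm_num)
    (ENNReal.mul_ne_top ENNReal.ofReal_ne_top (hC.image hf).measure_lt_top.ne)

theorem IsDiskMap.eLpNorm_lineDeriv_le {K : ℝ} (hK : 0 ≤ K) {f : ℂ → ℂ} (hf : IsDiskMap f)
    (hinj : Function.Injective f) (hfK : ∀ᵐ z, HasDistortionAt K f z) {v : ℂ} (hv : ‖v‖ = 1)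
    {A : Set ℂ} (hA : MeasurableSet A) (hA1 : A ⊆ closedBall 0 1) :
    eLpNorm (fun z => lineDeriv ℝ f z v) 2 (volume.restrict A) ≤
      (ENNReal.ofReal K * volume (closedBall (0 : ℂ) 1)) ^ (1 / 2 : ℝ) := by
  refine (_root_.eLpNorm_lineDeriv_le hK hinj hfK hv hA).trans ?_
  have himage : f '' A ⊆ closedBall 0 1 := by
    rintro _ ⟨z, hz, rfl⟩
    simpa using hf.norm_le z (by simpa using hA1 hz)
  gcongr

theorem isQuasiconformal_of_ae_hasDistortionAt {K : ℝ} (hK : 0 < K) {φ : ℂ → ℂ}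
    (hφ : IsHomeomorph φ) (hφK : ∀ᵐ z, HasDistortionAt K φ z)
    (hweak : ∀ v : ℂ, ‖v‖ = 1 → IsWeakPartial v φ fun z => lineDeriv ℝ φ z v) :
    IsQuasiconformal K φ := by
  have hL2 : ∀ {v : ℂ}, ‖v‖ = 1 → IsL2Loc fun z => lineDeriv ℝ φ z v :=
    isL2Loc_lineDeriv hK.le hφ.continuous hφ.injective hφK
  refine ⟨hφ, isL2Loc_of_continuous hφ.continuous, _, _, hweak 1 norm_one,
    hweak Complex.I Complex.norm_I, hL2 norm_one, hL2 Complex.norm_I, ?_, ?_⟩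
  · filter_upwards [hφK] with z ⟨L, hL, hLK⟩ α β
    have hdir : ∀ θ : ℝ, (Real.cos θ : ℂ) * L 1 + (Real.sin θ : ℂ) * L Complex.I =
        L (Complex.exp (θ * Complex.I)) := by
      intro θ
      rw [Complex.exp_mul_I, ← Complex.ofReal_cos, ← Complex.ofReal_sin, ← Complex.real_smul,
        ← Complex.real_smul, ← Complex.real_smul, ← map_smul, ← map_smul, ← map_add,
        Complex.real_smul, mul_one]
    simp only [(hL.hasLineDerivAt _).lineDeriv, hdir]
    exact hLK.norm_le_mul_norm hK (Complex.norm_exp_ofReal_mul_I α)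
      (Complex.norm_exp_ofReal_mul_I β)
  · filter_upwards [hφK] with z ⟨L, hL, hLK⟩
    simp only [(hL.hasLineDerivAt _).lineDeriv]
    rw [← det_clm_complex]
    exact hLK.det_nonneg hK

theorem volume_packingCantor_eq_zero (P : ℕ → DiskPacking) {a : ℝ} (ha : 1 < a) :
    volume (packingCantor P a) = 0 := by
  have hzero : μH[2] (packingCantor P a) = 0 :=
    (Measure.hausdorffMeasure_zero_or_top (div_lt_self two_pos ha) _).resolve_right
      (hausdorffMeasure_packingCantor_lt_top P ha.le).ne
  exact nonpos_iff_eq_zero.1 ((volume_le_hausdorffMeasure_two _).trans_eq hzero)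

theorem tendsto_volume_cantorStage (P : ℕ → DiskPacking) {a : ℝ} (ha : 1 < a) :
    Tendsto (fun N => volume (cantorStage P a N 0)) atTop (𝓝 0) := by
  rw [← volume_packingCantor_eq_zero P ha, packingCantor]
  exact tendsto_measure_iInter_atTop
    (fun N => (isCompact_cantorStage P a N 0).measurableSet.nullMeasurableSet)
    (antitone_cantorStage P ha.le 0) ⟨0, (isCompact_cantorStage P a 0 0).measure_lt_top.ne⟩

section cantorMap

variable (P : ℕ → DiskPacking) {a b : ℝ}

theorem isDiskMap_cantorMap (ha : 1 < a) (hb : 1 < b) : IsDiskMap (cantorMap P a b) where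
  continuous := continuous_cantorMap P ha hb
  eq_self z hz := tendsto_nhds_unique (tendsto_stageMap P ha hb z)
    (tendsto_const_nhds.congr fun N => ((isDiskMap_stageMap P ha hb N 0).eq_self z hz).symm)
  norm_le z hz := le_of_tendsto' (tendsto_stageMap P ha hb z).norm fun N =>
    (isDiskMap_stageMap P ha hb N 0).norm_le z hz

theorem cantorMap_eventuallyEq_stageMap (ha : 1 < a) (hb : 1 < b) {N : ℕ} {z : ℂ}
    (hz : z ∉ cantorStage P a N 0) : cantorMap P a b =ᶠ[𝓝 z] stageMap P a b N 0 := by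
  filter_upwards [(isCompact_cantorStage P a N 0).isClosed.isOpen_compl.mem_nhds hz] with w hw
  exact cantorMap_eq_stageMap P ha hb hw

theorem ae_hasDistortionAt_cantorMap (hb : 1 < b) (hba : b ≤ a) :
    ∀ᵐ z, HasDistortionAt ((a - 1) / (b - 1)) (cantorMap P a b) z := by
  have ha := hb.trans_le hba
  filter_upwards [measure_eq_zero_iff_ae_notMem.1 (volume_packingCantor_eq_zero P ha),
    ae_all_iff.2 fun N => ae_hasDistortionAt_stageMap P hb hba N 0] with z hz hstage
  simp only [packingCantor, mem_iInter, not_forall] at hz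
  obtain ⟨N, hN⟩ := hz
  exact (hstage N).congr_of_eventuallyEq (cantorMap_eventuallyEq_stageMap P ha hb hN)

theorem tendsto_eLpNorm_lineDeriv_stageMap_sub (hb : 1 < b) (hba : b ≤ a) {v : ℂ} (hv : ‖v‖ = 1) :
    Tendsto (fun N => eLpNorm ((fun z => lineDeriv ℝ (stageMap P a b N 0) z v) -
      fun z => lineDeriv ℝ (cantorMap P a b) z v) 1) atTop (𝓝 0) := by
  have ha := hb.trans_le hba
  have hK : 0 ≤ (a - 1) / (b - 1) := div_nonneg (by linarith) (by linarith)
  have hdisk := isDiskMap_cantorMap P ha hb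
  have hstage := fun N => isDiskMap_stageMap P ha hb N 0
  have hmeas : ∀ {f : ℂ → ℂ} (μ : Measure ℂ), IsDiskMap f →
      AEStronglyMeasurable (fun z => lineDeriv ℝ f z v) μ :=
    fun μ hf => aestronglyMeasurable_lineDeriv hf.continuous μ
  have henergy : ∀ {f : ℂ → ℂ} (N : ℕ), IsDiskMap f → Function.Injective f →
      (∀ᵐ z, HasDistortionAt ((a - 1) / (b - 1)) f z) →
      eLpNorm (fun z => lineDeriv ℝ f z v) 2 (volume.restrict (cantorStage P a N 0)) ≤
        (ENNReal.ofReal ((a - 1) / (b - 1)) * volume (closedBall (0 : ℂ) 1)) ^ (1 / 2 : ℝ) :=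
    fun N hf hinj hfK => hf.eLpNorm_lineDeriv_le hK hinj hfK hv
      (isCompact_cantorStage P a N 0).measurableSet (cantorStage_subset_closedBall P ha.le N 0)
  have hfinite : (ENNReal.ofReal ((a - 1) / (b - 1)) * volume (closedBall (0 : ℂ) 1)) ^ (1 / 2 : ℝ)
      ≠ ⊤ := ENNReal.rpow_ne_top_of_nonneg (by norm_num)
    (ENNReal.mul_ne_top ENNReal.ofReal_ne_top measure_closedBall_lt_top.ne)
  refine tendsto_eLpNorm_one_of_support_subset
    (fun N => (hmeas volume (hstage N)).sub (hmeas volume hdisk)) (fun N z hz => ?_)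
    (tendsto_volume_cantorStage P ha) (ENNReal.add_ne_top.2 ⟨hfinite, hfinite⟩) fun N =>
      (eLpNorm_sub_le (hmeas _ (hstage N)) (hmeas _ hdisk) (by norm_num)).trans (add_le_add
        (henergy N (hstage N) (leftInverse_stageMap P ha hb N 0).injective
          (ae_hasDistortionAt_stageMap P hb hba N 0))
        (henergy N hdisk (leftInverse_cantorMap P ha hb).injective
          (ae_hasDistortionAt_cantorMap P hb hba)))
  by_contra hzN
  refine hz (sub_eq_zero.2 ?_)
  exact (cantorMap_eventuallyEq_stageMap P ha hb hzN).lineDeriv_eq.symm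

theorem isWeakPartial_lineDeriv_cantorMap (hb : 1 < b) (hba : b ≤ a) {v : ℂ} (hv : ‖v‖ = 1) :
    IsWeakPartial v (cantorMap P a b) fun z => lineDeriv ℝ (cantorMap P a b) z v := by
  have ha := hb.trans_le hba
  have hK : 0 ≤ (a - 1) / (b - 1) := div_nonneg (by linarith) (by linarith)
  have hcont := fun N => (isDiskMap_stageMap P ha hb N 0).continuous
  refine isWeakPartial_of_tendstoUniformly hcont (tendstoUniformly_stageMap P ha hb)
    (fun N => ?_) (fun N => ?_) ?_ (tendsto_eLpNorm_lineDeriv_stageMap_sub P hb hba hv)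
  · obtain ⟨C, hC⟩ := exists_lipschitzWith_stageMap P (b := b) ha.le N 0
    exact isWeakPartial_lineDeriv_of_lipschitzWith hC v
  · exact (isL2Loc_lineDeriv hK (hcont N) (leftInverse_stageMap P ha hb N 0).injective
      (ae_hasDistortionAt_stageMap P hb hba N 0) hv).locallyIntegrable
  · exact (isL2Loc_lineDeriv hK (continuous_cantorMap P ha hb)
      (leftInverse_cantorMap P ha hb).injective
      (ae_hasDistortionAt_cantorMap P hb hba) hv).locallyIntegrable

theorem isQuasiconformal_cantorMap (hb : 1 < b) (hba : b ≤ a) :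
    IsQuasiconformal ((a - 1) / (b - 1)) (cantorMap P a b) :=
  isQuasiconformal_of_ae_hasDistortionAt (div_pos (by linarith) (by linarith))
    (isHomeomorph_cantorMap P (hb.trans_le hba) hb) (ae_hasDistortionAt_cantorMap P hb hba)
    fun _ hv => isWeakPartial_lineDeriv_cantorMap P hb hba hv

end cantorMap

/-! ### Gauge functions -/

theorem IsGauge.map_zero {g : ℝ → ℝ} (hg : IsGauge g) : g 0 = 0 :=
  tendsto_nhds_unique ((hg.continuousOn 0 self_mem_Ici).mono_left
    (nhdsWithin_mono 0 Ioi_subset_Ici_self)) hg.tendsto_zero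

theorem isGauge_rpow {d : ℝ} (hd : 0 < d) : IsGauge fun t => t ^ d where
  continuousOn := (Real.continuous_rpow_const hd.le).continuousOn
  monotoneOn := Real.monotoneOn_rpow_Ici_of_exponent_nonneg hd.le
  tendsto_zero := by
    simpa only [Real.zero_rpow hd.ne'] using
      ((Real.continuous_rpow_const hd.le).tendsto 0).mono_left nhdsWithin_le_nhds
  pos _ ht := Real.rpow_pos_of_pos ht d

theorem gaugeHausdorff_le_mul {g h : ℝ → ℝ} {ε η : ℝ} (hε : 0 < ε) (hη : 0 < η)
    (hgh : ∀ t ∈ Ico 0 η, g t ≤ ε * h t) (E : Set ℂ) :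
    gaugeHausdorff g E ≤ ENNReal.ofReal ε * gaugeHausdorff h E := by
  refine iSup₂_le fun δ hδ => ?_
  refine le_trans ?_ (mul_le_mul_right (le_iSup₂ (α := ℝ≥0∞) (min δ η) (lt_min hδ hη)) _)
  simp only [ENNReal.mul_iInf_of_ne (ENNReal.ofReal_pos.2 hε).ne' ENNReal.ofReal_ne_top]
  refine le_iInf fun z => le_iInf fun r => le_iInf fun hr => le_iInf fun hcover => ?_
  refine iInf_le_of_le z (iInf_le_of_le r (iInf_le_of_le
    (fun j => ⟨(hr j).1, (hr j).2.trans_le (min_le_left _ _)⟩) (iInf_le_of_le hcover ?_)))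
  rw [← ENNReal.tsum_mul_left]
  refine ENNReal.tsum_le_tsum fun j => ?_
  rw [← ENNReal.ofReal_mul hε.le]
  exact ENNReal.ofReal_le_ofReal (hgh _ ⟨mul_nonneg zero_le_two (hr j).1,
    (hr j).2.trans_le (min_le_right _ _)⟩)

theorem GaugePrec.exists_forall_le_mul {g h : ℝ → ℝ} (hgh : GaugePrec h g) (hg : IsGauge g)
    (hh : IsGauge h) {ε : ℝ} (hε : 0 < ε) : ∃ η > 0, ∀ t ∈ Ico 0 η, g t ≤ ε * h t := by
  obtain ⟨η, hη, hsub⟩ := mem_nhdsGT_iff_exists_Ioo_subset.1 (hgh.eventually_lt_const hε)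
  refine ⟨η, hη, fun t ⟨ht0, htη⟩ => ?_⟩
  rcases ht0.eq_or_lt with rfl | ht
  · rw [hg.map_zero, hh.map_zero, mul_zero]
  · exact ((div_lt_iff₀ (hh.pos t ht)).1 (hsub ⟨ht, htη⟩)).le

theorem GaugePrec.gaugeHausdorff_eq_zero {g h : ℝ → ℝ} (hgh : GaugePrec h g) (hg : IsGauge g)
    (hh : IsGauge h) {E : Set ℂ} (hE : gaugeHausdorff h E ≠ ⊤) : gaugeHausdorff g E = 0 := by
  have hle : ∀ ε : ℝ, 0 < ε → gaugeHausdorff g E ≤ ENNReal.ofReal ε * gaugeHausdorff h E := by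
    intro ε hε
    obtain ⟨η, hη, hη'⟩ := hgh.exists_forall_le_mul hg hh hε
    exact gaugeHausdorff_le_mul hε hη hη' E
  have hlim : Tendsto (fun ε : ℝ => ENNReal.ofReal ε * gaugeHausdorff h E) (𝓝[>] 0) (𝓝 0) := by
    have hofReal : Tendsto ENNReal.ofReal (𝓝[>] 0) (𝓝 0) := by
      simpa only [ENNReal.ofReal_zero] using
        (ENNReal.continuous_ofReal.tendsto 0).mono_left nhdsWithin_le_nhds
    simpa only [zero_mul] using ENNReal.Tendsto.mul_const hofReal (Or.inr hE)
  exact nonpos_iff_eq_zero.1 (ge_of_tendsto hlim (eventually_mem_nhdsWithin.mono hle))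

theorem gaugeHausdorff_rpow_lt_top {d : ℝ} (hd : 0 < d) {E : Set ℂ} (hE : μH[d] E < ⊤) :
    gaugeHausdorff (fun t => t ^ d) E < ⊤ :=
  (gaugeHausdorff_le_hausdorffMeasure d hd E).trans_lt
    (ENNReal.mul_lt_top (ENNReal.rpow_lt_top_of_nonneg hd.le ENNReal.ofNat_ne_top) hE)

theorem exists_isQuasiconformal_hausdorffMeasure_image {a b : ℝ} (hb : 1 < b) (hba : b ≤ a) :
    ∃ (E : Set ℂ) (φ : ℂ → ℂ), IsCompact E ∧ IsQuasiconformal ((a - 1) / (b - 1)) φ ∧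
      0 < μH[2 / a] E ∧ μH[2 / a] E < ⊤ ∧ 0 < μH[2 / b] (φ '' E) ∧ μH[2 / b] (φ '' E) < ⊤ := by
  obtain ⟨P, hP, hPb⟩ := exists_isAreaFilling_rpow_le_half hb
  have hPa : ∀ k, ∀ p ∈ (P k).disks, p.2 ^ a ≤ p.2 / 2 := fun k p hp =>
    (Real.rpow_le_rpow_of_exponent_ge ((P k).pos p hp) ((P k).le_one hp) hba).trans (hPb k p hp)
  have ha : 1 < a := hb.trans_le hba
  refine ⟨packingCantor P a, cantorMap P a b, isCompact_packingCantor P a,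
    isQuasiconformal_cantorMap P hb hba, hP.hausdorffMeasure_packingCantor_pos ha.le hPa,
    hausdorffMeasure_packingCantor_lt_top P ha.le, ?_⟩
  rw [image_cantorMap_packingCantor P ha hb]
  exact ⟨hP.hausdorffMeasure_packingCantor_pos hb.le hPb,
    hausdorffMeasure_packingCantor_lt_top P hb.le⟩

theorem exists_reciprocal_exponents {K d : ℝ} (hK : 1 ≤ K) (hd0 : 0 < d) (hd2 : d < 2) :
    ∃ a b : ℝ, 1 < b ∧ b ≤ a ∧ (a - 1) / (b - 1) = K ∧ 2 / a = d ∧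
      2 / b = 2 * K * d / (2 + (K - 1) * d) := by
  have hK0 : 0 < K := zero_lt_one.trans_le hK
  have ha : 0 < 2 / d - 1 := sub_pos.2 ((one_lt_div hd0).2 hd2)
  refine ⟨2 / d, 1 + (2 / d - 1) / K, lt_add_of_pos_right 1 (div_pos ha hK0), ?_, ?_, ?_, ?_⟩
  · linarith [div_le_self ha.le hK]
  · rw [add_sub_cancel_left, div_div_cancel₀ ha.ne']
  · exact div_div_cancel₀ two_ne_zero
  · have hb : 1 + (2 / d - 1) / K = (2 + (K - 1) * d) / (K * d) := by
      field_simp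
      ring
    rw [hb, div_div_eq_mul_div, mul_assoc]

/-- Write `d' = 2 K d / (2 + (K - 1) d)`. There is an extremal pair `(E, φ)` with `E` compact,
`φ` a `K`-quasiconformal mapping of the plane, and both `H^d(E)` and `H^{d'}(φ E)` positive and
finite. Moreover no relaxation `H^g(E) = 0`, `t ^ d ≺ g`, of the hypothesis of the implication
`H^d(E) = 0 ⇒ H^{d'}(φ E) = 0` yields the same conclusion. -/
theorem corollary3p4 (K : ℝ) (hK : 1 ≤ K) (d : ℝ) (hd0 : 0 < d) (hd2 : d < 2) :
    (∃ (E : Set ℂ) (φ : ℂ → ℂ), IsCompact E ∧ IsQuasiconformal K φ ∧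
      0 < μH[d] E ∧ μH[d] E < ⊤ ∧
      0 < μH[2 * K * d / (2 + (K - 1) * d)] (φ '' E) ∧
      μH[2 * K * d / (2 + (K - 1) * d)] (φ '' E) < ⊤) ∧
    ∀ g : ℝ → ℝ, IsGauge g → GaugePrec (fun t => t ^ d) g →
      ¬ ∀ (E : Set ℂ) (φ : ℂ → ℂ), IsCompact E → IsQuasiconformal K φ →
        gaugeHausdorff g E = 0 → μH[2 * K * d / (2 + (K - 1) * d)] (φ '' E) = 0 := by
  obtain ⟨a, b, hb, hba, hab, ha_d, hb_d'⟩ := exists_reciprocal_exponents hK hd0 hd2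
  obtain ⟨E, φ, hE, hφ, hE_pos, hE_fin, himage_pos, himage_fin⟩ :=
    exists_isQuasiconformal_hausdorffMeasure_image hb hba
  rw [hab] at hφ
  rw [ha_d] at hE_pos hE_fin
  rw [hb_d'] at himage_pos himage_fin
  refine ⟨⟨E, φ, hE, hφ, hE_pos, hE_fin, himage_pos, himage_fin⟩, fun g hg hdg himp => ?_⟩
  have hgE : gaugeHausdorff g E = 0 :=
    hdg.gaugeHausdorff_eq_zero hg (isGauge_rpow hd0) (gaugeHausdorff_rpow_lt_top hd0 hE_fin).ne
  exact himage_pos.ne' (himp E φ hE hφ hgE)
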